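/- Let $(\lambda_n)_{n\ge 1}\subset\mathbb R$ and $r_n>0$ be such that each disk $\mathbb D(\lambda_n,r_n)=\{z:|z-\lambda_n|<r_n\}$ is contained in the open unit disk $\mathbb D$ and the closed disks $\overline{\mathbb D(\lambda_n,r_n)}$ are pairwise disjoint. Put $K=\overline{\mathbb D}\setminus\bigcup_n \mathbb D(\lambda_n,r_n)$ and assume that $K\cap\mathbb R$ has empty interior in $\mathbb R$ and positive length (a "string of beads set"). Let $\Omega=\operatorname{int}(K)$, $\Omega_U=\{z\in\Omega:\operatorname{Im} z>0\}$, $\Omega_L=\Omega\setminus\Omega_U$, $K_U=\overline{\Omega_U}$, $K_L=\overline{\Omega_L}$, and let $A_W=W\,dA$ be the weighted area measure with $W(z)=\operatorname{dist}(z,\mathbb R)^4$ for $z\in\Omega$ and $W(z)=0$ otherwise. For a compact set $F\subset\mathbb C$ and a finite positive Borel measure $\mu$ on $F$, let $\mathrm{Rat}(F)$ be the set of rational functions with poles off $F$ and let $R^2(F,\mu)$ be the closure of $\mathrm{Rat}(F)$ in $L^2(\mu)$. The space $R^2(F,\mu)$ is called pure if it has no direct $L^2$ summand, i.e. there is no Borel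 set $\Delta$ with $\mu(\Delta)>0$ such that $R^2(F,\mu)=L^2(\mu|_\Delta)\oplus N$ for a subspace $N$ of $L^2(\mu|_{\mathbb C\setminus\Delta})$. Let $\mathrm{bpe}(R^2(F,\mu))$ be the set of $z\in F$ such that $f\mapsto f(z)$ is bounded on $\mathrm{Rat}(F)$ for the $L^2(\mu)$ norm, and let $\mathrm{abpe}(R^2(F,\mu))$ be the set of interior points $z_0$ of $\mathrm{bpe}(R^2(F,\mu))$ for which there are $r,M>0$ with $|f(z)|\le M\|f\|_{L^2(\mu)}$ for all $|z-z_0|<r$ and all $f\in\mathrm{Rat}(F)$. Then $R^2(K,A_W)$ is pure, $\mathrm{abpe}(R^2(K,A_W))=\Omega$, the characteristic function $\chi_{\Omega_U}$ belongs to $R^2(K,A_W)$, and $R^2(K,A_W)$ splits non-trivially as the orthogonal direct sum \[ R^2(K,A_W)=R^2(K_U,A_W|_{\Omega_U})\oplus R^2(K_L,A_W|_{\Omega_L}), \] where functions on $\Omega_U$ and on $\Omega_L$ are extended by zero and $A_W(\Omega_U)>0$, $A_W(\Omega_L)>0$. -/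

import Mathlib

open MeasureTheory
open scoped ENNReal NNReal

noncomputable section

namespace StringOfBeads

/-! ### The spaces `R^t(K, μ)`

Here `K` is a compact subset of `ℂ` and `μ` is a finite Borel measure carried by `K`. -/

/-- `Rat(K)`: the rational functions `p / q` with poles off `K`. Only the values at points of `K`
are meaningful (elsewhere `q` may vanish, and division by zero gives the value `0`). -/
def Rat (K : Set ℂ) : Set (ℂ → ℂ) :=
  {f | ∃ p q : Polynomial ℂ, (∀ z ∈ K, q.eval z ≠ 0) ∧ f = fun z => p.eval z / q.eval z}

/-- `R^t(K, μ)`: the closure of `Rat(K)` in `L^t(μ)`. When `μ` is carried by `K`, the classes of the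
members of `Rat(K)` already form a linear subspace, so that the span adds nothing. -/
def R (K : Set ℂ) (t : ℝ≥0∞) [Fact (1 ≤ t)] (μ : Measure ℂ) : Submodule ℂ (Lp ℂ t μ) :=
  (Submodule.span ℂ {f : Lp ℂ t μ | ∃ g ∈ Rat K, f =ᵐ[μ] g}).topologicalClosure

/-- The bounded point evaluations for `R^t(K, μ)`: the points `z` at which `f ↦ f z` is defined on
all of `Rat(K)` (that is, `z ∈ K`) and bounded with respect to the `L^t(μ)` norm. -/
def bpe (K : Set ℂ) (t : ℝ≥0∞) (μ : Measure ℂ) : Set ℂ :=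
  {z | z ∈ K ∧ ∃ M : ℝ≥0, ∀ f ∈ Rat K, ‖f z‖ₑ ≤ M * eLpNorm f t μ}

/-- The analytic bounded point evaluations for `R^t(K, μ)`. -/
def abpe (K : Set ℂ) (t : ℝ≥0∞) (μ : Measure ℂ) : Set ℂ :=
  {z₀ | z₀ ∈ interior (bpe K t μ) ∧ ∃ r : ℝ, 0 < r ∧ ∃ M : ℝ≥0,
    ∀ z ∈ Metric.ball z₀ r, ∀ f ∈ Rat K, ‖f z‖ₑ ≤ M * eLpNorm f t μ}

/-- A subspace `N` of `L^t(μ|_A)` regarded as a subspace of `L^t(μ)` through extension by zero: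
the `f ∈ L^t(μ)` that vanish a.e. off `A` and whose restriction to `A` lies in `N`. -/
def extendByZero {t : ℝ≥0∞} [Fact (1 ≤ t)] {μ : Measure ℂ} (A : Set ℂ)
    (N : Submodule ℂ (Lp ℂ t (μ.restrict A))) : Submodule ℂ (Lp ℂ t μ) :=
  N.comap (LpToLpRestrictCLM ℂ ℂ ℂ μ t A).toLinearMap ⊓
    LinearMap.ker (LpToLpRestrictCLM ℂ ℂ ℂ μ t Aᶜ).toLinearMap

/-- Multiplication by `z` on `R^t(K, μ)` is pure: `R^t(K, μ)` has no direct `L^t` summand, i.e. there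
is no Borel set `Δ` with `μ(Δ) > 0` and no subspace `N` of `L^t(μ|_{Δᶜ})` such that
`R^t(K, μ) = L^t(μ|_Δ) ⊕ N`. -/
def IsPure (K : Set ℂ) (t : ℝ≥0∞) [Fact (1 ≤ t)] (μ : Measure ℂ) : Prop :=
  ¬ ∃ Δ : Set ℂ, MeasurableSet Δ ∧ 0 < μ Δ ∧ ∃ N : Submodule ℂ (Lp ℂ t (μ.restrict Δᶜ)),
    R K t μ = extendByZero Δ ⊤ ⊔ extendByZero Δᶜ N

/-! ### String of beads sets -/

/-- The closed unit disk with the open disks of centre `lam n` and radius `r n` removed. -/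
def beadSet (lam r : ℕ → ℝ) : Set ℂ :=
  Metric.closedBall (0 : ℂ) 1 \ ⋃ n, Metric.ball (lam n : ℂ) (r n)

/-- The centres `lam n` and the radii `r n` define a string of beads set `beadSet lam r`. -/
structure IsStringOfBeads (lam r : ℕ → ℝ) : Prop where
  radius_pos : ∀ n, 0 < r n
  ball_subset : ∀ n, Metric.ball (lam n : ℂ) (r n) ⊆ Metric.ball (0 : ℂ) 1
  disjoint : ∀ i j, i ≠ j →
    Disjoint (Metric.closedBall (lam i : ℂ) (r i)) (Metric.closedBall (lam j : ℂ) (r j))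
  real_interior : interior {x : ℝ | (x : ℂ) ∈ beadSet lam r} = ∅
  real_length_pos : 0 < volume {x : ℝ | (x : ℂ) ∈ beadSet lam r}

/-- `Ω = int(K)`. -/
def Om (K : Set ℂ) : Set ℂ := interior K

/-- `Ω_U`, the part of `Ω` in the open upper half plane. -/
def OmU (K : Set ℂ) : Set ℂ := {z ∈ Om K | 0 < z.im}

/-- `Ω_L = Ω \ Ω_U`. -/
def OmL (K : Set ℂ) : Set ℂ := Om K \ OmU K

/-- `K_U`, the closure of `Ω_U`. -/
def KU (K : Set ℂ) : Set ℂ := closure (OmU K)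

/-- `K_L`, the closure of `Ω_L`. -/
def KL (K : Set ℂ) : Set ℂ := closure (OmL K)

/-- The weight `W(z) = dist(z, ℝ)^4` on `Ω`, and `0` off `Ω`. -/
def weight (K : Set ℂ) : ℂ → ℝ :=
  (Om K).indicator fun z => Metric.infDist z (Set.range ((↑) : ℝ → ℂ)) ^ 4

/-- The weighted area measure `W dA`. -/
def areaW (K : Set ℂ) : Measure ℂ :=
  (volume : Measure ℂ).withDensity fun z => ENNReal.ofReal (weight K z)

end StringOfBeads

end

namespace StringOfBeads

/-! Since `K ∩ ℝ` has no interior in `ℝ`, the open set `Ω` misses the real axis and `Ω_U`, `Ω_L` lie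
in opposite open half planes. Everything hinges on `χ_{Ω_U} ∈ R²(K, W dA)`. The Cayley quotient `(w
- i)/(w + i)` has modulus `< 1` above the axis and `> 1` below it, so `(w + i)^n / ((w + i)^n - c (w
- i)^n)` with `|c| = 1` tends to `1` above and to `0` below. Its poles are real and, by Baire, `c`
can be chosen so that they all avoid `K` (`exists_unimodular_no_zero`). The error is at most `2/|Im
w|`, which is square integrable for the weight `|Im w|^4`; dominated convergence gives
`inR_indicator_OmU`.

For the splitting, `χ_{Ω_U} h` must lie in `R²(K, W dA)` for every `h` with poles off `K_U`.
Factoring the denominator reduces this to `(z - a)⁻¹` with `a ∉ K_U`, which is a uniform limit on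
`Ω_U` of members of `Rat(K)`: either `a` is a limit of points off `K` and the pole is moved, or `a ∈
Ω_L` and a disk containing `Ω_U` but not `a` gives polynomial approximants (`uniformlyApprox_OmU`).

The mean value property over disks, with `W` bounded below on compact subsets of `Ω`, bounds point
evaluations locally on `Ω` (`abpe_eq_Om`). It survives `L²` limits (`ae_mean_value`), so `R²` cannot
contain the indicator of a set of small positive measure, as an `L²` summand would force
(`isPure_areaW`). -/

/-! ### The weight, the measure and the position of `Ω` relative to the real axis. -/

theorem infDist_range_ofReal (z : ℂ) :
    Metric.infDist z (Set.range ((↑) : ℝ → ℂ)) = |z.im| := by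
  apply le_antisymm
  · have h := Metric.infDist_le_dist_of_mem (x := z) (Set.mem_range_self (f := ((↑) : ℝ → ℂ)) z.re)
    refine h.trans_eq ?_
    rw [Complex.dist_of_re_eq (by simp)]
    simp
  · refine (Metric.le_infDist ⟨_, Set.mem_range_self 0⟩).2 ?_
    rintro _ ⟨x, rfl⟩
    rw [Complex.dist_eq]
    simpa using Complex.abs_im_le_norm (z - x)

theorem weight_of_mem {K : Set ℂ} {z : ℂ} (hz : z ∈ Om K) : weight K z = |z.im| ^ 4 := by
  simp [weight, hz, infDist_range_ofReal]

theorem weight_of_notMem {K : Set ℂ} {z : ℂ} (hz : z ∉ Om K) : weight K z = 0 := by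
  simp [weight, hz]

theorem isOpen_Om (K : Set ℂ) : IsOpen (Om K) := isOpen_interior

theorem isOpen_OmU (K : Set ℂ) : IsOpen (OmU K) :=
  (isOpen_Om K).inter (isOpen_lt continuous_const Complex.continuous_im)

theorem measurableSet_OmU (K : Set ℂ) : MeasurableSet (OmU K) := (isOpen_OmU K).measurableSet

theorem measurableSet_OmL (K : Set ℂ) : MeasurableSet (OmL K) :=
  (isOpen_Om K).measurableSet.diff (measurableSet_OmU K)

theorem measurable_weight (K : Set ℂ) : Measurable (weight K) :=
  ((Metric.continuous_infDist_pt _).pow 4).measurable.indicator (isOpen_Om K).measurableSet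

theorem measurable_ofReal_weight (K : Set ℂ) :
    Measurable fun z => ENNReal.ofReal (weight K z) :=
  (measurable_weight K).ennreal_ofReal

theorem ae_mem_Om (K : Set ℂ) : ∀ᵐ z ∂areaW K, z ∈ Om K := by
  rw [areaW, ae_withDensity_iff (measurable_ofReal_weight K)]
  refine Filter.Eventually.of_forall fun z hz => ?_
  by_contra hzK
  exact hz (by simp [weight_of_notMem hzK])

theorem abs_im_le_one {K : Set ℂ} (hK : K ⊆ Metric.closedBall 0 1) {z : ℂ} (hz : z ∈ Om K) :
    |z.im| ≤ 1 := by
  have := hK (interior_subset hz)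
  rw [mem_closedBall_zero_iff] at this
  exact (Complex.abs_im_le_norm z).trans this

/-- This is where the weight enters: `|Im z|^4 · |Im z|⁻² = |Im z|² ≤ 1` on `Ω`. The function serves
as the dominating function for the Cayley approximants. -/
theorem memLp_inv_im {K : Set ℂ} (hK : K ⊆ Metric.closedBall 0 1) :
    MemLp (fun z : ℂ => z.im⁻¹) 2 (areaW K) := by
  have hm : Measurable fun z : ℂ => z.im⁻¹ := Complex.measurable_im.inv
  refine ⟨hm.aestronglyMeasurable, ?_⟩
  rw [eLpNorm_lt_top_iff_lintegral_rpow_enorm_lt_top (by norm_num) (by norm_num), areaW,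
    lintegral_withDensity_eq_lintegral_mul _ (measurable_ofReal_weight K)
      (by exact hm.enorm.pow_const _)]
  have hfin : ∫⁻ z : ℂ, (Metric.closedBall (0 : ℂ) 1).indicator (fun _ => (1 : ℝ≥0∞)) z < ∞ := by
    rw [lintegral_indicator_const measurableSet_closedBall, one_mul]
    exact measure_closedBall_lt_top
  refine lt_of_le_of_lt (lintegral_mono fun z => ?_) hfin
  by_cases hz : z ∈ Om K
  · have h1 := abs_im_le_one hK hz
    rw [Set.indicator_of_mem (hK (interior_subset hz))]
    simp only [Pi.mul_apply, weight_of_mem hz, ENNReal.toReal_ofNat]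
    rw [← ofReal_norm, ENNReal.ofReal_rpow_of_nonneg (norm_nonneg _) (by norm_num),
      ← ENNReal.ofReal_mul (by positivity)]
    rw [← ENNReal.ofReal_one]
    apply ENNReal.ofReal_le_ofReal
    rcases eq_or_ne z.im 0 with h0 | h0
    · simp [h0]
    · have : |z.im| ^ 4 * ‖z.im⁻¹‖ ^ (2 : ℝ) = |z.im| ^ 2 := by
        have : |z.im| ≠ 0 := abs_ne_zero.2 h0
        rw [norm_inv, Real.norm_eq_abs, Real.rpow_two]
        field_simp
      rw [this]
      exact pow_le_one₀ (abs_nonneg _) h1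
  · simp [weight_of_notMem hz]

theorem isFiniteMeasure_areaW {K : Set ℂ} (hK : K ⊆ Metric.closedBall 0 1) :
    IsFiniteMeasure (areaW K) := by
  refine isFiniteMeasure_withDensity ?_
  have hfin : ∫⁻ z : ℂ, (Metric.closedBall (0 : ℂ) 1).indicator (fun _ => (1 : ℝ≥0∞)) z < ∞ := by
    rw [lintegral_indicator_const measurableSet_closedBall, one_mul]
    exact measure_closedBall_lt_top
  refine (lt_of_le_of_lt (lintegral_mono fun z => ?_) hfin).ne
  by_cases hz : z ∈ Om K
  · rw [Set.indicator_of_mem (hK (interior_subset hz)), weight_of_mem hz]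
    exact ENNReal.ofReal_le_one.2 (pow_le_one₀ (abs_nonneg _) (abs_im_le_one hK hz))
  · simp [weight_of_notMem hz]

/-- `Ω ∩ ℝ` is a relatively open subset of `K ∩ ℝ`, hence empty. -/
theorem im_ne_zero_of_mem_Om {K : Set ℂ} (hint : interior {x : ℝ | (x : ℂ) ∈ K} = ∅) {z : ℂ}
    (hz : z ∈ Om K) : z.im ≠ 0 := by
  intro h0
  have hsub : ((↑) : ℝ → ℂ) ⁻¹' Om K ⊆ interior {x : ℝ | (x : ℂ) ∈ K} :=
    interior_maximal (fun x hx => interior_subset (s := K) hx)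
      ((isOpen_Om K).preimage Complex.continuous_ofReal)
  have : z.re ∈ interior {x : ℝ | (x : ℂ) ∈ K} := by
    apply hsub
    have : ((z.re : ℝ) : ℂ) = z := Complex.ext (by simp) (by simp [h0])
    rwa [Set.mem_preimage, this]
  simp [hint] at this

theorem mem_OmL_iff {K : Set ℂ} (hint : interior {x : ℝ | (x : ℂ) ∈ K} = ∅) {z : ℂ} :
    z ∈ OmL K ↔ z ∈ Om K ∧ z.im < 0 := by
  constructor
  · rintro ⟨h1, h2⟩
    refine ⟨h1, lt_of_le_of_ne ?_ (im_ne_zero_of_mem_Om hint h1)⟩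
    by_contra h
    exact h2 ⟨h1, not_le.1 h⟩
  · rintro ⟨h1, h2⟩
    exact ⟨h1, fun h => lt_asymm h2 h.2⟩

/-! ### Algebra of `Rat` -/

theorem Rat.poly (K : Set ℂ) (p : Polynomial ℂ) : (fun z => p.eval z) ∈ Rat K :=
  ⟨p, 1, by simp, by simp⟩

theorem Rat.mul {K : Set ℂ} {f g : ℂ → ℂ} (hf : f ∈ Rat K) (hg : g ∈ Rat K) :
    (fun z => f z * g z) ∈ Rat K := by
  obtain ⟨p, q, hq, rfl⟩ := hf
  obtain ⟨p', q', hq', rfl⟩ := hg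
  refine ⟨p * p', q * q', fun z hz => ?_, ?_⟩
  · simpa using ⟨hq z hz, hq' z hz⟩
  · funext z
    simp [div_mul_div_comm]

theorem Rat.inv_sub {K : Set ℂ} {a : ℂ} (ha : a ∉ K) : (fun z => (z - a)⁻¹) ∈ Rat K :=
  ⟨1, Polynomial.X - Polynomial.C a, fun z hz h => ha (by
    have : z = a := by simpa [sub_eq_zero] using h
    exact this ▸ hz), by simp⟩

theorem Rat.mono {K L : Set ℂ} (h : K ⊆ L) : Rat L ⊆ Rat K := by
  rintro f ⟨p, q, hq, rfl⟩
  exact ⟨p, q, fun z hz => hq z (h hz), rfl⟩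

theorem Rat.measurable {K : Set ℂ} {f : ℂ → ℂ} (hf : f ∈ Rat K) : Measurable f := by
  obtain ⟨p, q, -, rfl⟩ := hf
  exact p.continuous.measurable.div q.continuous.measurable

theorem Rat.continuousOn {K : Set ℂ} {f : ℂ → ℂ} (hf : f ∈ Rat K) : ContinuousOn f K := by
  obtain ⟨p, q, hq, rfl⟩ := hf
  exact p.continuous.continuousOn.div q.continuous.continuousOn hq

theorem Rat.differentiableOn {K : Set ℂ} {f : ℂ → ℂ} (hf : f ∈ Rat K) :
    DifferentiableOn ℂ f K := by
  obtain ⟨p, q, hq, rfl⟩ := hf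
  exact p.differentiable.differentiableOn.div q.differentiable.differentiableOn hq

theorem Rat.memLp_top {K : Set ℂ} (hK : IsCompact K) {μ : Measure ℂ} (hμ : ∀ᵐ z ∂μ, z ∈ K)
    {f : ℂ → ℂ} (hf : f ∈ Rat K) : MemLp f ∞ μ := by
  obtain ⟨C, hC⟩ := hK.exists_bound_of_continuousOn (Rat.continuousOn hf)
  exact memLp_top_of_bound (Rat.measurable hf).aestronglyMeasurable C (hμ.mono hC)

/-! ### Functions whose class lies in `R` -/

/-- The class of the function `f` belongs to `R²(K, μ)`. -/
def InR (K : Set ℂ) (μ : Measure ℂ) (f : ℂ → ℂ) : Prop :=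
  ∃ F ∈ R K 2 μ, F =ᵐ[μ] f

theorem InR.memLp {K : Set ℂ} {μ : Measure ℂ} {f : ℂ → ℂ} (hf : InR K μ f) : MemLp f 2 μ := by
  obtain ⟨F, -, hF⟩ := hf
  exact (memLp_congr_ae hF).1 (Lp.memLp F)

theorem InR.congr {K : Set ℂ} {μ : Measure ℂ} {f g : ℂ → ℂ} (hf : InR K μ f) (h : f =ᵐ[μ] g) :
    InR K μ g := by
  obtain ⟨F, hF, hF'⟩ := hf
  exact ⟨F, hF, hF'.trans h⟩

theorem InR.mem {K : Set ℂ} {μ : Measure ℂ} {F : Lp ℂ 2 μ} {f : ℂ → ℂ} (hf : InR K μ f)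
    (h : F =ᵐ[μ] f) : F ∈ R K 2 μ := by
  obtain ⟨G, hG, hG'⟩ := hf
  rwa [show F = G from Lp.ext (h.trans hG'.symm)]

theorem InR.add {K : Set ℂ} {μ : Measure ℂ} {f g : ℂ → ℂ} (hf : InR K μ f) (hg : InR K μ g) :
    InR K μ (f + g) := by
  obtain ⟨F, hF, hF'⟩ := hf
  obtain ⟨G, hG, hG'⟩ := hg
  exact ⟨F + G, add_mem hF hG, (Lp.coeFn_add F G).trans (hF'.add hG')⟩

theorem InR.const_smul {K : Set ℂ} {μ : Measure ℂ} {f : ℂ → ℂ} (c : ℂ) (hf : InR K μ f) :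
    InR K μ (c • f) := by
  obtain ⟨F, hF, hF'⟩ := hf
  exact ⟨c • F, Submodule.smul_mem _ c hF, (Lp.coeFn_smul c F).trans (hF'.const_smul c)⟩

theorem InR.sub {K : Set ℂ} {μ : Measure ℂ} {f g : ℂ → ℂ} (hf : InR K μ f) (hg : InR K μ g) :
    InR K μ (f - g) := by
  obtain ⟨F, hF, hF'⟩ := hf
  obtain ⟨G, hG, hG'⟩ := hg
  exact ⟨F - G, sub_mem hF hG, (Lp.coeFn_sub F G).trans (hF'.sub hG')⟩

theorem InR.of_rat {K : Set ℂ} {μ : Measure ℂ} {f : ℂ → ℂ} (hf : f ∈ Rat K)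
    (hf2 : MemLp f 2 μ) : InR K μ f :=
  ⟨hf2.toLp f, Submodule.le_topologicalClosure _ (Submodule.subset_span ⟨f, hf, hf2.coeFn_toLp⟩),
    hf2.coeFn_toLp⟩

theorem InR.of_tendsto {K : Set ℂ} {μ : Measure ℂ} {f : ℕ → ℂ → ℂ} {g : ℂ → ℂ}
    (hf : ∀ n, InR K μ (f n)) (hg : MemLp g 2 μ)
    (h : Filter.Tendsto (fun n => eLpNorm (f n - g) 2 μ) Filter.atTop (nhds 0)) : InR K μ g := by
  have ht := (Lp.tendsto_Lp_iff_tendsto_eLpNorm'' f (fun n => (hf n).memLp) g hg).2 h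
  refine ⟨hg.toLp g, ?_, hg.coeFn_toLp⟩
  refine (Submodule.isClosed_topologicalClosure _).mem_of_tendsto ht
    (Filter.Eventually.of_forall fun n => ?_)
  exact (hf n).mem (MemLp.coeFn_toLp _)

/-- A continuous linear map sending the classes of rational functions into a closed subspace
sends all of `R²(K, μ)` into it. -/
theorem R_le_comap {K : Set ℂ} {μ : Measure ℂ} {E : Type*} [NormedAddCommGroup E]
    [NormedSpace ℂ E] (T : Lp ℂ 2 μ →L[ℂ] E) {S : Submodule ℂ E} (hS : IsClosed (S : Set E))
    (h : ∀ F : Lp ℂ 2 μ, (∃ g ∈ Rat K, F =ᵐ[μ] g) → T F ∈ S) :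
    R K 2 μ ≤ S.comap T.toLinearMap := by
  refine Submodule.topologicalClosure_minimal _ (Submodule.span_le.2 fun F hF => h F hF) ?_
  exact hS.preimage T.continuous

/-- `g` is bounded on `K`, so multiplication by it is continuous on `L²`; as it preserves `Rat(K)`,
it preserves the closure. -/
theorem InR.mul_rat {K : Set ℂ} (hK : IsCompact K) {μ : Measure ℂ} (hμ : ∀ᵐ z ∂μ, z ∈ K)
    {g f : ℂ → ℂ} (hg : g ∈ Rat K) (hf : InR K μ f) : InR K μ (fun z => g z * f z) := by
  have hgt := Rat.memLp_top hK hμ hg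
  let T : Lp ℂ 2 μ →L[ℂ] Lp ℂ 2 μ := (ContinuousLinearMap.mul ℂ ℂ).holderL μ ∞ 2 2 (hgt.toLp g)
  have hT : ∀ F : Lp ℂ 2 μ, T F =ᵐ[μ] fun z => g z * F z := by
    intro F
    refine (ContinuousLinearMap.coeFn_holder (r := 2) (B := ContinuousLinearMap.mul ℂ ℂ)
      (hgt.toLp g) F).trans ?_
    filter_upwards [hgt.coeFn_toLp] with z hz
    simp [hz]
  obtain ⟨F, hF, hF'⟩ := hf
  refine ⟨T F, R_le_comap T (Submodule.isClosed_topologicalClosure _) ?_ hF, (hT F).trans ?_⟩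
  · rintro G ⟨k, hk, hGk⟩
    refine Submodule.le_topologicalClosure _
      (Submodule.subset_span ⟨_, Rat.mul hg hk, (hT G).trans ?_⟩)
    filter_upwards [hGk] with z hz
    rw [hz]
  · filter_upwards [hF'] with z hz
    rw [hz]

/-- Dominated convergence in `L²`. -/
theorem tendsto_eLpNorm_two_of_dominated {μ : Measure ℂ} {f : ℕ → ℂ → ℂ} {g : ℂ → ℂ} {G : ℂ → ℝ}
    (hf : ∀ n, AEStronglyMeasurable (f n) μ) (hg : AEStronglyMeasurable g μ) (hG : MemLp G 2 μ)
    (hb : ∀ n, ∀ᵐ z ∂μ, ‖f n z - g z‖ ≤ G z)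
    (hlim : ∀ᵐ z ∂μ, Filter.Tendsto (fun n => f n z) Filter.atTop (nhds (g z))) :
    Filter.Tendsto (fun n => eLpNorm (f n - g) 2 μ) Filter.atTop (nhds 0) := by
  have h1 : Filter.Tendsto (fun n => ∫⁻ z, ‖f n z - g z‖ₑ ^ (2 : ℝ) ∂μ) Filter.atTop
      (nhds (∫⁻ _, 0 ∂μ)) := by
    refine tendsto_lintegral_of_dominated_convergence' (fun z => ‖G z‖ₑ ^ (2 : ℝ))
      (fun n => ((hf n).sub hg).enorm.pow_const _) (fun n => ?_) ?_ ?_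
    · filter_upwards [hb n] with z hz
      refine ENNReal.rpow_le_rpow ?_ (by norm_num)
      rw [← ofReal_norm, ← ofReal_norm]
      exact ENNReal.ofReal_le_ofReal (hz.trans (le_abs_self _))
    · have := (eLpNorm_lt_top_iff_lintegral_rpow_enorm_lt_top (p := 2) (by norm_num)
        (by norm_num)).1 hG.2
      simpa using this.ne
    · filter_upwards [hlim] with z hz
      have h2 : Filter.Tendsto (fun n => f n z - g z) Filter.atTop (nhds 0) := by
        simpa using hz.sub_const (g z)
      have h3 := ((ENNReal.continuous_rpow_const (y := (2 : ℝ))).tendsto _).comp h2.enorm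
      simpa [Function.comp_def] using h3
  have h4 := ((ENNReal.continuous_rpow_const (y := (1 / 2 : ℝ))).tendsto _).comp h1
  simp only [lintegral_zero] at h4
  rw [ENNReal.zero_rpow_of_pos (by norm_num)] at h4
  refine h4.congr fun n => ?_
  rw [eLpNorm_eq_lintegral_rpow_enorm_toReal (by norm_num) (by norm_num)]
  simp

/-! ### Cayley approximants of the characteristic function of the upper half plane. -/

/-- The angle coordinate `θ = arctan x` turns the Cayley quotient on the real line into a rotation,
so that the real zeros of `(x + i)^n - c (x - i)^n` become translates of one angle by multiples of
`π/n`. -/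
theorem ofReal_add_I_eq_exp_arctan_mul (x : ℝ) :
    ((x : ℂ) + Complex.I) =
      -Complex.exp (-(2 * Real.arctan x : ℝ) * Complex.I) * ((x : ℂ) - Complex.I) := by
  set θ := Real.arctan x with hθ
  have hc : (Real.cos θ : ℂ) ≠ 0 := by
    exact_mod_cast (Real.cos_arctan_pos x).ne'
  have hx : (x : ℂ) = Real.sin θ / Real.cos θ := by
    rw [← Complex.ofReal_div, ← Real.tan_eq_sin_div_cos, hθ, Real.tan_arctan]
  have he : Complex.exp (-(2 * θ : ℝ) * Complex.I) =
      (Real.cos θ - Real.sin θ * Complex.I) ^ 2 := by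
    have : (Real.cos θ - Real.sin θ * Complex.I : ℂ) = Complex.exp (-θ * Complex.I) := by
      rw [Complex.exp_mul_I, Complex.cos_neg, Complex.sin_neg]
      push_cast
      ring
    rw [this, ← Complex.exp_nat_mul]
    congr 1
    push_cast
    ring
  have hsc : (Real.sin θ : ℂ) ^ 2 + (Real.cos θ : ℂ) ^ 2 = 1 := by
    exact_mod_cast Real.sin_sq_add_cos_sq θ
  rw [he, hx]
  field_simp
  generalize (Real.sin θ : ℂ) = s at *
  generalize (Real.cos θ : ℂ) = c at *
  linear_combination (-s - c * Complex.I) * hsc +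
    (2 * s * c ^ 2 - s ^ 2 * c * Complex.I + s ^ 3) * Complex.I_sq

/-- If `K ∩ ℝ` is compact with empty interior, a unimodular `c` can be chosen so that the zeros of
`(w + i)^n - c (w - i)^n`, all of them real, avoid `K`. -/
theorem exists_unimodular_no_zero {K : Set ℂ} (hK : IsCompact K)
    (hint : interior {x : ℝ | (x : ℂ) ∈ K} = ∅) {n : ℕ} (hn : n ≠ 0) :
    ∃ c : ℂ, ‖c‖ = 1 ∧ ∀ w ∈ K, (w + Complex.I) ^ n - c * (w - Complex.I) ^ n ≠ 0 := by
  set S : Set ℝ := {x : ℝ | (x : ℂ) ∈ K} with hS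
  have hSc : IsCompact S := Complex.isometry_ofReal.isClosedEmbedding.isCompact_preimage hK
  set T : Set ℝ := Real.arctan '' S with hT
  have hTc : IsClosed T := (hSc.image Real.continuous_arctan).isClosed
  have hTi : interior T = ∅ := by
    have hsub : Real.arctan ⁻¹' interior T ⊆ interior S := by
      refine interior_maximal (fun x hx => ?_) (isOpen_interior.preimage Real.continuous_arctan)
      obtain ⟨y, hy, hxy⟩ := interior_subset hx
      rwa [← Real.arctan_injective hxy]
    rw [Set.eq_empty_iff_forall_notMem]
    intro t ht
    obtain ⟨x, hx, rfl⟩ := interior_subset ht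
    have : x ∈ interior S := hsub ht
    simp [hint] at this
  -- Baire: `T` is closed with empty interior, so some `α` has all its translates `α + kπ/n` outside
  -- `T`.
  have hdense : Dense (⋂ k : ℤ, (fun α : ℝ => α + k * Real.pi / n) ⁻¹' Tᶜ) := by
    refine dense_iInter_of_isOpen (fun k => hTc.isOpen_compl.preimage (by fun_prop)) fun k => ?_
    have h1 : Dense Tᶜ := interior_eq_empty_iff_dense_compl.1 hTi
    exact h1.preimage (Homeomorph.addRight (k * Real.pi / n : ℝ)).isOpenMap
  obtain ⟨α, hα⟩ := hdense.nonempty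
  simp only [Set.mem_iInter, Set.mem_preimage, Set.mem_compl_iff] at hα
  -- This `c` is the value of `((x + i)/(x - i))^n` at the angle `α`.
  refine ⟨(-Complex.exp (-(2 * α : ℝ) * Complex.I)) ^ n, ?_, fun w hw h0 => ?_⟩
  · have := Complex.norm_exp_ofReal_mul_I (-(2 * α))
    push_cast at this ⊢
    rw [norm_pow, norm_neg, this, one_pow]
  · have heq := sub_eq_zero.1 h0
    -- As `|c| = 1`, a zero is equidistant from `i` and `-i`.
    have him : w.im = 0 := by
      have h1 : ‖w + Complex.I‖ ^ n = ‖w - Complex.I‖ ^ n := by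
        have := congrArg norm heq
        have h2 := Complex.norm_exp_ofReal_mul_I (-(2 * α))
        push_cast at this h2
        rwa [norm_pow, norm_mul, norm_pow, norm_neg, norm_pow, h2, one_pow, one_mul] at this
      have h2 := (pow_left_inj₀ (norm_nonneg _) (norm_nonneg _) hn).1 h1
      have h3 : ‖w + Complex.I‖ ^ 2 = ‖w - Complex.I‖ ^ 2 := by rw [h2]
      rw [Complex.sq_norm, Complex.sq_norm, Complex.normSq_apply, Complex.normSq_apply] at h3
      simp at h3
      nlinarith
    obtain ⟨x, rfl⟩ : ∃ x : ℝ, (x : ℂ) = w := ⟨w.re, Complex.ext (by simp) (by simp [him])⟩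
    have hx0 : ((x : ℂ) - Complex.I) ^ n ≠ 0 := by
      refine pow_ne_zero _ fun h => ?_
      have := congrArg Complex.im h
      simp at this
    rw [ofReal_add_I_eq_exp_arctan_mul x, mul_pow] at heq
    have h1 := mul_right_cancel₀ hx0 heq
    rw [neg_pow, neg_pow (Complex.exp (-(2 * α : ℝ) * Complex.I))] at h1
    have h2 := mul_left_cancel₀ (pow_ne_zero n (by norm_num : (-1 : ℂ) ≠ 0)) h1
    rw [← Complex.exp_nat_mul, ← Complex.exp_nat_mul, Complex.exp_eq_exp_iff_exists_int] at h2
    obtain ⟨k, hk⟩ := h2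
    -- Comparing exponents gives `arctan x = α - kπ/n`, a translate excluded by the choice of `α`.
    refine hα (-k) ?_ |>.elim
    refine ⟨x, hw, ?_⟩
    have hk' := congrArg Complex.im hk
    simp [-Complex.ofReal_arctan] at hk'
    push_cast
    have hn' : (n : ℝ) ≠ 0 := by exact_mod_cast hn
    field_simp
    linarith

theorem norm_add_I_sq_sub (w : ℂ) :
    ‖w + Complex.I‖ ^ 2 - ‖w - Complex.I‖ ^ 2 = 4 * w.im := by
  rw [Complex.sq_norm, Complex.sq_norm, Complex.normSq_apply, Complex.normSq_apply]
  simp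
  ring

/-- If `0 ≤ s ≤ 1 - d` then `1 - s ^ n` is bounded below by `d`. -/
theorem le_one_sub_pow {s d : ℝ} (hs : 0 ≤ s) (hd : 0 ≤ d) (h : s ≤ 1 - d) {n : ℕ} (hn : n ≠ 0) :
    d ≤ 1 - s ^ n := by
  have : s ^ n ≤ s := pow_le_of_le_one hs (by linarith) hn
  linarith

/-- `1 - a/b = 4d / (b(a + b))` and `b(a + b) ≤ 8`. It is applied to `|w ± i|`, both at most `2` on
the unit disk, with `d = |Im w|`. -/
theorem ratio_le {a b d : ℝ} (ha : 0 ≤ a) (ha2 : a ≤ 2) (hb : 0 < b) (hb2 : b ≤ 2)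
    (h : b ^ 2 - a ^ 2 = 4 * d) (hd : 0 ≤ d) : a / b ≤ 1 - d / 2 := by
  rw [div_le_iff₀ hb]
  have hab : a ≤ b := by nlinarith
  nlinarith [mul_nonneg hd (sub_nonneg.2 hb2), mul_nonneg hd hb.le,
    mul_nonneg (sub_nonneg.2 hab) (sub_nonneg.2 hb2), mul_nonneg (sub_nonneg.2 hab) ha]

/-- The rational functions `(w + i)^n / ((w + i)^n - c (w - i)^n)` are close to `1` in the upper
half plane. -/
theorem norm_cayley_sub_one_le {u v c : ℂ} (hc : ‖c‖ = 1) (n : ℕ) (huv : ‖u‖ < ‖v‖) (hn : n ≠ 0) :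
    ‖v ^ n / (v ^ n - c * u ^ n) - 1‖ ≤ (‖u‖ / ‖v‖) ^ n / (1 - (‖u‖ / ‖v‖) ^ n) := by
  have hv : 0 < ‖v‖ := (norm_nonneg u).trans_lt huv
  have hlt : ‖u‖ ^ n < ‖v‖ ^ n := pow_lt_pow_left₀ huv (norm_nonneg _) hn
  have hge : ‖v‖ ^ n - ‖u‖ ^ n ≤ ‖v ^ n - c * u ^ n‖ := by
    have := norm_sub_norm_le (v ^ n) (c * u ^ n)
    simpa [hc] using this
  have hne : v ^ n - c * u ^ n ≠ 0 := by
    rw [← norm_pos_iff]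
    linarith
  have h1 : v ^ n / (v ^ n - c * u ^ n) - 1 = c * u ^ n / (v ^ n - c * u ^ n) := by
    field_simp
    ring
  have h2 : (‖u‖ / ‖v‖) ^ n / (1 - (‖u‖ / ‖v‖) ^ n) = ‖u‖ ^ n / (‖v‖ ^ n - ‖u‖ ^ n) := by
    have hvn : ‖v‖ ^ n ≠ 0 := (pow_pos hv n).ne'
    rw [div_pow]
    field_simp
  rw [h1, h2, norm_div, norm_mul, norm_pow, hc, one_mul]
  exact div_le_div_of_nonneg_left (by positivity) (by linarith) hge

theorem norm_cayley_le {u v c : ℂ} (hc : ‖c‖ = 1) (n : ℕ) (huv : ‖v‖ < ‖u‖) (hn : n ≠ 0) :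
    ‖v ^ n / (v ^ n - c * u ^ n)‖ ≤ (‖v‖ / ‖u‖) ^ n / (1 - (‖v‖ / ‖u‖) ^ n) := by
  have hu : 0 < ‖u‖ := (norm_nonneg v).trans_lt huv
  have hlt : ‖v‖ ^ n < ‖u‖ ^ n := pow_lt_pow_left₀ huv (norm_nonneg _) hn
  have hge : ‖u‖ ^ n - ‖v‖ ^ n ≤ ‖v ^ n - c * u ^ n‖ := by
    have := norm_sub_norm_le (c * u ^ n) (v ^ n)
    rw [norm_sub_rev] at this
    simpa [hc] using this
  have h2 : (‖v‖ / ‖u‖) ^ n / (1 - (‖v‖ / ‖u‖) ^ n) = ‖v‖ ^ n / (‖u‖ ^ n - ‖v‖ ^ n) := by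
    have hun : ‖u‖ ^ n ≠ 0 := (pow_pos hu n).ne'
    rw [div_pow]
    field_simp
  rw [h2, norm_div, norm_pow]
  exact div_le_div_of_nonneg_left (by positivity) (by linarith) hge

/-- The first bound gives pointwise convergence; the second, uniform in `n`, gives the dominating
function. -/
theorem geometric_bound {s d : ℝ} (hs : 0 ≤ s) (hd : 0 < d) (h : s ≤ 1 - d) {n : ℕ} (hn : n ≠ 0) :
    s ^ n / (1 - s ^ n) ≤ s ^ n / d ∧ s ^ n / d ≤ d⁻¹ := by
  have h1 := le_one_sub_pow hs hd.le h hn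
  refine ⟨div_le_div_of_nonneg_left (by positivity) hd h1, ?_⟩
  rw [div_eq_mul_inv]
  exact mul_le_of_le_one_left (by positivity) (by linarith)

/-- Rational functions with poles off `K` converging to the characteristic function of the upper
half plane, with a bound `2 / |Im w|` for the distance. -/
theorem exists_rat_near_upper {K : Set ℂ} (hK : IsCompact K) (hK1 : K ⊆ Metric.closedBall 0 1)
    (hint : interior {x : ℝ | (x : ℂ) ∈ K} = ∅) :
    ∃ f : ℕ → ℂ → ℂ, (∀ n, f n ∈ Rat K) ∧
      ∀ w ∈ K, w.im ≠ 0 → ∀ χ : ℂ, (0 < w.im → χ = 1) → (w.im < 0 → χ = 0) →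
        (∀ n, ‖f n w - χ‖ ≤ 2 * |w.im|⁻¹) ∧
        Filter.Tendsto (fun n => f n w) Filter.atTop (nhds χ) := by
  choose c hc hc0 using fun n : ℕ => exists_unimodular_no_zero hK hint n.succ_ne_zero
  refine ⟨fun n w => (w + Complex.I) ^ (n + 1) /
    ((w + Complex.I) ^ (n + 1) - c n * (w - Complex.I) ^ (n + 1)), fun n => ?_, ?_⟩
  · refine ⟨(Polynomial.X + Polynomial.C Complex.I) ^ (n + 1),
      (Polynomial.X + Polynomial.C Complex.I) ^ (n + 1) -
        Polynomial.C (c n) * (Polynomial.X - Polynomial.C Complex.I) ^ (n + 1), ?_, ?_⟩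
    · intro w hw
      simpa using hc0 n w hw
    · simp
  · intro w hw him χ hχ1 hχ0
    have hw1 : ‖w‖ ≤ 1 := by simpa using hK1 hw
    have hp : ‖w + Complex.I‖ ≤ 2 := (norm_add_le _ _).trans (by simp; linarith)
    have hm : ‖w - Complex.I‖ ≤ 2 := (norm_sub_le _ _).trans (by simp; linarith)
    have hsq := norm_add_I_sq_sub w
    -- `s` is the smaller of `|w + i|`, `|w - i|` divided by the larger, so one estimate covers both
    -- half planes.
    obtain ⟨s, hs0, hsd, hb⟩ : ∃ s : ℝ, 0 ≤ s ∧ s ≤ 1 - |w.im| / 2 ∧ ∀ n,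
        ‖(w + Complex.I) ^ (n + 1) /
          ((w + Complex.I) ^ (n + 1) - c n * (w - Complex.I) ^ (n + 1)) - χ‖ ≤
          s ^ (n + 1) / (1 - s ^ (n + 1)) := by
      rcases him.lt_or_gt with h | h
      · have hlt : ‖w + Complex.I‖ < ‖w - Complex.I‖ :=
          lt_of_pow_lt_pow_left₀ 2 (norm_nonneg _) (by linarith)
        refine ⟨‖w + Complex.I‖ / ‖w - Complex.I‖, by positivity, ?_, fun n => ?_⟩
        rotate_left
        · rw [hχ0 h, sub_zero]
          exact norm_cayley_le (hc n) _ hlt n.succ_ne_zero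
        · rw [abs_of_neg h]
          exact ratio_le (norm_nonneg _) hp ((norm_nonneg _).trans_lt hlt) hm (by linarith)
            (by linarith)
      · have hlt : ‖w - Complex.I‖ < ‖w + Complex.I‖ :=
          lt_of_pow_lt_pow_left₀ 2 (norm_nonneg _) (by linarith)
        refine ⟨‖w - Complex.I‖ / ‖w + Complex.I‖, by positivity, ?_, fun n => ?_⟩
        rotate_left
        · rw [hχ1 h]
          exact norm_cayley_sub_one_le (hc n) _ hlt n.succ_ne_zero
        · rw [abs_of_pos h]
          exact ratio_le (norm_nonneg _) hm ((norm_nonneg _).trans_lt hlt) hp (by linarith)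
            (by linarith)
    have hd : 0 < |w.im| / 2 := by positivity
    have hg := fun n : ℕ => geometric_bound hs0 hd hsd n.succ_ne_zero
    constructor
    · intro n
      refine ((hb n).trans ((hg n).1.trans (hg n).2)).trans_eq ?_
      rw [inv_div, div_eq_mul_inv]
    · rw [tendsto_iff_norm_sub_tendsto_zero]
      refine squeeze_zero (fun n => norm_nonneg _) (fun n => (hb n).trans (hg n).1) ?_
      have := (tendsto_pow_atTop_nhds_zero_of_lt_one hs0 (by linarith)).comp
        (Filter.tendsto_add_atTop_nat 1)
      simpa using this.div_const (|w.im| / 2)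

theorem ae_mem (K : Set ℂ) : ∀ᵐ z ∂areaW K, z ∈ K :=
  (ae_mem_Om K).mono fun _ hz => interior_subset hz

theorem Rat.memLp_two {K : Set ℂ} (hK : IsCompact K) (hK1 : K ⊆ Metric.closedBall 0 1)
    {f : ℂ → ℂ} (hf : f ∈ Rat K) : MemLp f 2 (areaW K) := by
  have := isFiniteMeasure_areaW hK1
  exact (Rat.memLp_top hK (ae_mem K) hf).mono_exponent le_top

theorem InR.rat {K : Set ℂ} (hK : IsCompact K) (hK1 : K ⊆ Metric.closedBall 0 1)
    {f : ℂ → ℂ} (hf : f ∈ Rat K) : InR K (areaW K) f :=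
  InR.of_rat hf (Rat.memLp_two hK hK1 hf)

/-- The characteristic function of `Ω_U` belongs to `R²(K, W dA)`. -/
theorem inR_indicator_OmU {K : Set ℂ} (hK : IsCompact K) (hK1 : K ⊆ Metric.closedBall 0 1)
    (hint : interior {x : ℝ | (x : ℂ) ∈ K} = ∅) :
    InR K (areaW K) ((OmU K).indicator fun _ => 1) := by
  have := isFiniteMeasure_areaW hK1
  obtain ⟨f, hf, hfK⟩ := exists_rat_near_upper hK hK1 hint
  have hmem : MemLp ((OmU K).indicator fun _ => (1 : ℂ)) 2 (areaW K) :=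
    (memLp_const 1).indicator (measurableSet_OmU K)
  have key : ∀ᵐ w ∂areaW K, (∀ n, ‖f n w - (OmU K).indicator (fun _ => 1) w‖ ≤ 2 * |w.im|⁻¹) ∧
      Filter.Tendsto (fun n => f n w) Filter.atTop
        (nhds ((OmU K).indicator (fun _ => 1) w)) := by
    filter_upwards [ae_mem_Om K] with w hw
    refine hfK w (interior_subset hw) (im_ne_zero_of_mem_Om hint hw) _ (fun h => ?_) fun h => ?_
    · exact Set.indicator_of_mem (s := OmU K) ⟨hw, h⟩ _
    · exact Set.indicator_of_notMem (s := OmU K) (fun h' => lt_asymm h h'.2) _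
  refine InR.of_tendsto (fun n => InR.rat hK hK1 (hf n)) hmem ?_
  refine tendsto_eLpNorm_two_of_dominated (G := fun w => 2 * |w.im|⁻¹)
    (fun n => (Rat.measurable (hf n)).aestronglyMeasurable) hmem.1 ?_
    (fun n => key.mono fun w hw => hw.1 n) (key.mono fun w hw => hw.2)
  have := ((memLp_inv_im hK1).abs).const_mul 2
  simpa [abs_inv] using this

theorem inR_indicator_OmL {K : Set ℂ} (hK : IsCompact K) (hK1 : K ⊆ Metric.closedBall 0 1)
    (hint : interior {x : ℝ | (x : ℂ) ∈ K} = ∅) :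
    InR K (areaW K) ((OmL K).indicator fun _ => 1) := by
  have h1 : InR K (areaW K) fun _ => 1 := InR.rat hK hK1 (by simpa using Rat.poly K 1)
  refine (h1.sub (inR_indicator_OmU hK hK1 hint)).congr ?_
  filter_upwards [ae_mem_Om K] with w hw
  by_cases h : w ∈ OmU K
  · have h' : w ∉ OmL K := fun h' => h'.2 h
    simp [h, h']
  · have h' : w ∈ OmL K := ⟨hw, h⟩
    simp [h, h']

/-! ### Approximating simple poles uniformly by members of `Rat(K)`. -/

/-- The function `z ↦ (z - a)⁻¹` is a uniform limit on `U` of members of `Rat(K)`. -/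
def UniformlyApprox (K U : Set ℂ) (a : ℂ) : Prop :=
  ∀ ε : ℝ, 0 < ε → ∃ m ∈ Rat K, ∀ z ∈ U, ‖m z - (z - a)⁻¹‖ ≤ ε

theorem exists_pos_le_norm_sub {U : Set ℂ} {a : ℂ} (ha : a ∉ closure U) :
    ∃ d : ℝ, 0 < d ∧ ∀ z ∈ U, d ≤ ‖z - a‖ := by
  rw [Metric.mem_closure_iff] at ha
  push Not at ha
  obtain ⟨d, hd, h⟩ := ha
  refine ⟨d, hd, fun z hz => ?_⟩
  rw [norm_sub_rev, ← dist_eq_norm]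
  exact h z hz

theorem uniformlyApprox_of_mem_closure_compl {K U : Set ℂ} {a : ℂ} (ha : a ∉ closure U)
    (haK : a ∈ closure Kᶜ) : UniformlyApprox K U a := by
  intro ε hε
  obtain ⟨d, hd, hU⟩ := exists_pos_le_norm_sub ha
  -- `d/2` keeps `b` at distance at least `d/2` from `U`; then the error `|b - a| / (|z - b| |z -
  -- a|)` is at most `|b - a| · 2/d² ≤ ε`.
  obtain ⟨b, hb, hab⟩ := Metric.mem_closure_iff.1 haK (min (d / 2) (ε * d ^ 2 / 2))
    (by positivity)
  refine ⟨_, Rat.inv_sub hb, fun z hz => ?_⟩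
  rw [dist_eq_norm, norm_sub_rev] at hab
  have hz1 := hU z hz
  have hab1 := hab.trans_le (min_le_left _ _)
  have hab2 := hab.trans_le (min_le_right _ _)
  have hz2 : d / 2 ≤ ‖z - b‖ := by
    have := norm_sub_norm_le (z - a) (b - a)
    rw [sub_sub_sub_cancel_right] at this
    linarith
  have hne1 : z - a ≠ 0 := norm_pos_iff.1 (hd.trans_le hz1)
  have hne2 : z - b ≠ 0 := norm_pos_iff.1 ((half_pos hd).trans_le hz2)
  have : (z - b)⁻¹ - (z - a)⁻¹ = (b - a) / ((z - b) * (z - a)) := by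
    field_simp
    ring
  rw [this, norm_div, norm_mul]
  have hprod : d / 2 * d ≤ ‖z - b‖ * ‖z - a‖ := by gcongr
  rw [div_le_iff₀ (lt_of_lt_of_le (by positivity) hprod)]
  nlinarith

/-- Expansion of `(z - a)⁻¹` in a geometric series on a disk around `b` not containing `a`. -/
theorem uniformlyApprox_of_disk (K : Set ℂ) {U : Set ℂ} {a b : ℂ} {ρ : ℝ} (hab : a ≠ b)
    (hρ : ρ < 1) (hU : ∀ z ∈ U, ‖z - b‖ ≤ ρ * ‖a - b‖) : UniformlyApprox K U a := by
  intro ε hε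
  have hab0 : a - b ≠ 0 := sub_ne_zero.2 hab
  have habn : 0 < ‖a - b‖ := norm_pos_iff.2 hab0
  have hD : 0 < (1 - ρ) * ‖a - b‖ := mul_pos (by linarith) habn
  obtain ⟨N, hN⟩ := exists_pow_lt_of_lt_one (mul_pos hε hD) hρ
  -- With `t = (z - b)/(a - b)` one has `z - a = (a - b)(t - 1)`; the partial sum leaves the
  -- remainder `-t^N / (z - a)`.
  refine ⟨_, Rat.poly K (Polynomial.C (-(a - b)⁻¹) * ∑ k ∈ Finset.range N,
    (Polynomial.C (a - b)⁻¹ * (Polynomial.X - Polynomial.C b)) ^ k), fun z hz => ?_⟩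
  have hz1 := hU z hz
  have hza : (1 - ρ) * ‖a - b‖ ≤ ‖z - a‖ := by
    have := norm_sub_norm_le (a - b) (z - b)
    rw [sub_sub_sub_cancel_right, norm_sub_rev a z] at this
    linarith
  have hza0 : z - a ≠ 0 := norm_pos_iff.1 (hD.trans_le hza)
  set t : ℂ := (a - b)⁻¹ * (z - b) with ht
  have ht1 : ‖t‖ ≤ ρ := by
    rw [ht, norm_mul, norm_inv, inv_mul_le_iff₀ habn]
    linarith
  have h1t : t - 1 = (a - b)⁻¹ * (z - a) := by
    rw [ht]
    field_simp
    ring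
  have ht0 : t ≠ 1 := sub_ne_zero.1 (by rw [h1t]; exact mul_ne_zero (inv_ne_zero hab0) hza0)
  have heq : (Polynomial.C (-(a - b)⁻¹) * ∑ k ∈ Finset.range N,
      (Polynomial.C (a - b)⁻¹ * (Polynomial.X - Polynomial.C b)) ^ k).eval z - (z - a)⁻¹ =
      -t ^ N / (z - a) := by
    simp only [Polynomial.eval_mul, Polynomial.eval_C, Polynomial.eval_finsetSum,
      Polynomial.eval_pow, Polynomial.eval_sub, Polynomial.eval_X, ← ht]
    rw [geom_sum_eq ht0, h1t]
    field_simp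
    ring
  rw [heq, norm_div, norm_neg, norm_pow, div_le_iff₀ (hD.trans_le hza)]
  calc ‖t‖ ^ N ≤ ρ ^ N := pow_le_pow_left₀ (norm_nonneg _) ht1 N
    _ ≤ ε * ((1 - ρ) * ‖a - b‖) := hN.le
    _ ≤ ε * ‖z - a‖ := by gcongr

/-- A point of the half plane opposite to the one containing the bounded set `U`. -/
theorem uniformlyApprox_of_half_plane (K : Set ℂ) {U : Set ℂ} (hU1 : U ⊆ Metric.closedBall 0 1)
    {a : ℂ} {σ : ℝ} (hU : ∀ z ∈ U, 0 ≤ σ * z.im) (ha : σ * a.im < 0) :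
    UniformlyApprox K U a := by
  set s : ℝ := -(σ * a.im) with hs
  have hs0 : 0 < s := by linarith
  -- The centre is scaled so that the cross term of `|a - b|²` is exactly `2`: then `|a - b|² ≥ 2 +
  -- (σ/s)²`, whereas `|z - b|² ≤ 1 + (σ/s)²` on `U`.
  set b : ℂ := ((σ / s : ℝ) : ℂ) * Complex.I with hb
  have hsq : ∀ z : ℂ, ‖z - b‖ ^ 2 = ‖z‖ ^ 2 - 2 * (σ * z.im) / s + (σ / s) ^ 2 := by
    intro z
    rw [Complex.sq_norm, Complex.sq_norm, Complex.normSq_apply, Complex.normSq_apply]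
    simp [hb]
    field_simp
    ring
  have haq : 2 + (σ / s) ^ 2 ≤ ‖a - b‖ ^ 2 := by
    rw [hsq, show σ * a.im = -s by rw [hs]; ring]
    have : 2 * -s / s = -2 := by field_simp
    rw [this]
    nlinarith [sq_nonneg ‖a‖]
  have hpos : 0 < ‖a - b‖ := by
    by_contra h
    have : ‖a - b‖ = 0 := le_antisymm (not_lt.1 h) (norm_nonneg _)
    rw [this] at haq
    nlinarith [sq_nonneg (σ / s)]
  refine uniformlyApprox_of_disk K (b := b) (ρ := √(1 + (σ / s) ^ 2) / ‖a - b‖)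
    (sub_ne_zero.1 (norm_pos_iff.1 hpos)) ?_ fun z hz => ?_
  · rw [div_lt_one hpos, Real.sqrt_lt' hpos]
    linarith
  · rw [div_mul_cancel₀ _ hpos.ne']
    apply Real.le_sqrt_of_sq_le
    rw [hsq]
    have h1 : ‖z‖ ≤ 1 := by simpa using hU1 hz
    have h2 : 0 ≤ 2 * (σ * z.im) / s := by
      have := hU z hz
      positivity
    nlinarith [norm_nonneg z]

theorem uniformlyApprox_OmU {K : Set ℂ} (hK1 : K ⊆ Metric.closedBall 0 1)
    (hint : interior {x : ℝ | (x : ℂ) ∈ K} = ∅) {a : ℂ} (ha : a ∉ KU K) :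
    UniformlyApprox K (OmU K) a := by
  by_cases haK : a ∈ Om K
  · refine uniformlyApprox_of_half_plane K (fun z hz => hK1 (interior_subset hz.1)) (σ := 1)
      (fun z hz => by simpa using hz.2.le) ?_
    have : a ∈ OmL K := ⟨haK, fun h => ha (subset_closure h)⟩
    simpa using ((mem_OmL_iff hint).1 this).2
  · exact uniformlyApprox_of_mem_closure_compl ha (by rwa [closure_compl])

theorem uniformlyApprox_OmL {K : Set ℂ} (hK1 : K ⊆ Metric.closedBall 0 1)
    (hint : interior {x : ℝ | (x : ℂ) ∈ K} = ∅) {a : ℂ} (ha : a ∉ KL K) :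
    UniformlyApprox K (OmL K) a := by
  by_cases haK : a ∈ Om K
  · refine uniformlyApprox_of_half_plane K (fun z hz => hK1 (interior_subset hz.1)) (σ := -1)
      (fun z hz => by simpa using ((mem_OmL_iff hint).1 hz).2.le) ?_
    have : a ∈ OmU K := by
      by_contra h
      exact ha (subset_closure ⟨haK, h⟩)
    simpa using this.2
  · exact uniformlyApprox_of_mem_closure_compl ha (by rwa [closure_compl])

/-- If `m n` is within `1/(n + 1)` of `(z - a)⁻¹` on `U`, multiplying by `m n` stays in `R²` and
errs by at most `|f|/(n + 1)` on `U`. One pole is added at a time. -/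
theorem InR.indicator_mul_inv_sub {K : Set ℂ} (hK : IsCompact K) {μ : Measure ℂ}
    (hμ : ∀ᵐ z ∂μ, z ∈ K) {U : Set ℂ} {a : ℂ} (ha : UniformlyApprox K U a)
    {f : ℂ → ℂ} (hf : InR K μ (U.indicator f)) :
    InR K μ (U.indicator fun z => (z - a)⁻¹ * f z) := by
  choose m hm hmU using fun n : ℕ => ha (1 / (n + 1)) (by positivity)
  have hInR := fun n => hf.mul_rat hK hμ (hm n)
  have hmeas : Measurable fun z : ℂ => (z - a)⁻¹ := (measurable_id.sub_const a).inv
  have hfun : (U.indicator fun z => (z - a)⁻¹ * f z) = fun z => (z - a)⁻¹ * U.indicator f z := by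
    funext z
    by_cases h : z ∈ U <;> simp [h]
  have hb : ∀ n : ℕ, ∀ z, ‖m n z * U.indicator f z - (U.indicator fun z => (z - a)⁻¹ * f z) z‖ ≤
      1 / ((n : ℝ) + 1) * ‖U.indicator f z‖ := by
    intro n z
    by_cases h : z ∈ U
    · simp only [h, Set.indicator_of_mem]
      rw [← sub_mul, norm_mul]
      gcongr
      exact hmU n z h
    · simp [h]
  have hae : AEStronglyMeasurable (U.indicator fun z => (z - a)⁻¹ * f z) μ := by
    rw [hfun]
    exact hmeas.aestronglyMeasurable.mul hf.memLp.1
  have hmem : MemLp (U.indicator fun z => (z - a)⁻¹ * f z) 2 μ := by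
    have h1 : MemLp ((fun z => m 0 z * U.indicator f z) - U.indicator fun z => (z - a)⁻¹ * f z)
        2 μ :=
      MemLp.of_le hf.memLp ((hInR 0).memLp.1.sub hae)
        (Filter.Eventually.of_forall fun z => by simpa using hb 0 z)
    simpa using (hInR 0).memLp.sub h1
  refine InR.of_tendsto hInR hmem ?_
  refine tendsto_eLpNorm_two_of_dominated (G := fun z => ‖U.indicator f z‖)
    (fun n => (hInR n).memLp.1) hae hf.memLp.norm
    (fun n => Filter.Eventually.of_forall fun z => (hb n z).trans ?_)
    (Filter.Eventually.of_forall fun z => ?_)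
  · refine mul_le_of_le_one_left (norm_nonneg _) ?_
    rw [div_le_one (by positivity)]
    linarith [(Nat.cast_nonneg n : (0 : ℝ) ≤ n)]
  · rw [tendsto_iff_norm_sub_tendsto_zero]
    refine squeeze_zero (fun n => norm_nonneg _) (fun n => hb n z) ?_
    simpa using (tendsto_one_div_add_atTop_nhds_zero_nat (𝕜 := ℝ)).mul_const ‖U.indicator f z‖

theorem InR.indicator_prod_inv_sub {K : Set ℂ} (hK : IsCompact K) {μ : Measure ℂ}
    (hμ : ∀ᵐ z ∂μ, z ∈ K) {U : Set ℂ} (hU : InR K μ (U.indicator fun _ => 1)) (s : Multiset ℂ)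
    (hs : ∀ a ∈ s, UniformlyApprox K U a) :
    InR K μ (U.indicator fun z => (s.map fun a => (z - a)⁻¹).prod) := by
  induction s using Multiset.induction_on with
  | empty => simpa using hU
  | cons a s ih =>
    have := (ih fun b hb => hs b (Multiset.mem_cons_of_mem hb)).indicator_mul_inv_sub hK hμ
      (hs a (Multiset.mem_cons_self a s))
    simpa using this

/-- The extension by zero of a rational function with poles off `closure U`. -/
theorem inR_indicator_rat {K : Set ℂ} (hK : IsCompact K) {μ : Measure ℂ}
    (hμ : ∀ᵐ z ∂μ, z ∈ K) {U : Set ℂ} (hU : InR K μ (U.indicator fun _ => 1))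
    (happ : ∀ a ∉ closure U, UniformlyApprox K U a) {h : ℂ → ℂ} (hh : h ∈ Rat (closure U)) :
    InR K μ (U.indicator h) := by
  obtain ⟨p, q, hq, rfl⟩ := hh
  have hroots : ∀ a ∈ q.roots, UniformlyApprox K U a := fun a ha =>
    happ a fun haU => hq a haU (Polynomial.isRoot_of_mem_roots ha)
  have h1 := (InR.indicator_prod_inv_sub hK hμ hU q.roots hroots).mul_rat hK hμ
    (Rat.poly K (Polynomial.C q.leadingCoeff⁻¹ * p))
  refine h1.congr (Filter.Eventually.of_forall fun z => ?_)
  by_cases hz : z ∈ U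
  · simp only [hz, Set.indicator_of_mem]
    have hqz : q.eval z = q.leadingCoeff * (q.roots.map fun a => z - a).prod :=
      (IsAlgClosed.splits q).eval_eq_prod_roots z
    rw [hqz, Multiset.prod_map_inv]
    simp only [Polynomial.eval_mul, Polynomial.eval_C]
    rw [div_eq_mul_inv, mul_inv]
    ring
  · simp [hz]

/-! ### Extension by zero and the orthogonal splitting. -/

theorem mem_extendByZero {μ : Measure ℂ} {U : Set ℂ} {N : Submodule ℂ (Lp ℂ 2 (μ.restrict U))}
    {G : Lp ℂ 2 μ} : G ∈ extendByZero U N ↔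
      LpToLpRestrictCLM ℂ ℂ ℂ μ 2 U G ∈ N ∧ G =ᵐ[μ.restrict Uᶜ] 0 := by
  have h : LpToLpRestrictCLM ℂ ℂ ℂ μ 2 Uᶜ G = 0 ↔ G =ᵐ[μ.restrict Uᶜ] 0 := by
    rw [Lp.eq_zero_iff_ae_eq_zero]
    have := LpToLpRestrictCLM_coeFn (p := 2) ℂ Uᶜ G
    exact ⟨fun h => this.symm.trans h, fun h => this.trans h⟩
  simp only [extendByZero, Submodule.mem_inf, Submodule.mem_comap, LinearMap.mem_ker,
    ContinuousLinearMap.coe_coe, h]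

theorem R_le_comap_restrict {K V : Set ℂ} (hV : V ⊆ K) (μ : Measure ℂ) (U : Set ℂ) :
    R K 2 μ ≤ (R V 2 (μ.restrict U)).comap (LpToLpRestrictCLM ℂ ℂ ℂ μ 2 U).toLinearMap := by
  refine R_le_comap _ (Submodule.isClosed_topologicalClosure _) ?_
  rintro F ⟨g, hg, hFg⟩
  exact Submodule.le_topologicalClosure _ (Submodule.subset_span
    ⟨g, Rat.mono hV hg, (LpToLpRestrictCLM_coeFn ℂ U F).trans (ae_restrict_of_ae hFg)⟩)

/-- Extension by zero is linear and isometric, so the property passes from `Rat(V)` to its span and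
then to the closure. -/
theorem inR_indicator_of_mem_R {K V : Set ℂ} {μ : Measure ℂ} {U : Set ℂ} (hU : MeasurableSet U)
    (h : ∀ f ∈ Rat V, InR K μ (U.indicator f)) {g : Lp ℂ 2 (μ.restrict U)}
    (hg : g ∈ R V 2 (μ.restrict U)) : InR K μ (U.indicator g) := by
  have hspan : ∀ g : Lp ℂ 2 (μ.restrict U), g ∈ Submodule.span ℂ
      {f : Lp ℂ 2 (μ.restrict U) | ∃ k ∈ Rat V, f =ᵐ[μ.restrict U] k} →
      InR K μ (U.indicator g) := by
    intro g hg
    induction hg using Submodule.span_induction with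
    | mem f hf =>
      obtain ⟨k, hk, hfk⟩ := hf
      exact (h k hk).congr ((ae_eq_restrict_iff_indicator_ae_eq hU).1 hfk.symm)
    | zero =>
      have h0 : InR K μ 0 := ⟨0, zero_mem _, Lp.coeFn_zero _ _ _⟩
      refine h0.congr ?_
      have := (ae_eq_restrict_iff_indicator_ae_eq hU).1
        (Lp.coeFn_zero ℂ 2 (μ.restrict U)).symm
      simpa using this
    | add f k _ _ hf hk =>
      refine (hf.add hk).congr ?_
      rw [← Set.indicator_add']
      exact (ae_eq_restrict_iff_indicator_ae_eq hU).1 (Lp.coeFn_add f k).symm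
    | smul c f _ hf =>
      refine (hf.const_smul c).congr ?_
      have hs : c • U.indicator f = U.indicator (c • ⇑f) :=
        (Set.indicator_const_smul U c f).symm
      rw [hs]
      exact (ae_eq_restrict_iff_indicator_ae_eq hU).1 (Lp.coeFn_smul c f).symm
  obtain ⟨u, hu, hlim⟩ := mem_closure_iff_seq_limit.1 hg
  refine InR.of_tendsto (fun n => hspan (u n) (hu n))
    ((memLp_indicator_iff_restrict hU).2 (Lp.memLp g)) ?_
  have := (Lp.tendsto_Lp_iff_tendsto_eLpNorm' u g).1 hlim
  refine this.congr fun n => ?_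
  rw [← Set.indicator_sub', eLpNorm_indicator_eq_eLpNorm_restrict hU]

theorem extendByZero_R_le {K V : Set ℂ} {μ : Measure ℂ} {U : Set ℂ} (hU : MeasurableSet U)
    (h : ∀ f ∈ Rat V, InR K μ (U.indicator f)) :
    extendByZero U (R V 2 (μ.restrict U)) ≤ R K 2 μ := by
  intro G hG
  obtain ⟨h1, h2⟩ := mem_extendByZero.1 hG
  refine (inR_indicator_of_mem_R hU h h1).mem ?_
  have h3 := (ae_eq_restrict_iff_indicator_ae_eq hU).1
    (LpToLpRestrictCLM_coeFn (p := 2) ℂ U G)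
  refine Filter.EventuallyEq.trans ?_ h3.symm
  filter_upwards [(ae_restrict_iff' hU.compl).1 h2] with z hz
  by_cases hzU : z ∈ U
  · simp [hzU]
  · simpa [hzU] using hz hzU

theorem indicator_mem_extendByZero {K V : Set ℂ} (hV : V ⊆ K) {μ : Measure ℂ} {U : Set ℂ}
    (hU : MeasurableSet U) {F : Lp ℂ 2 μ} (hF : F ∈ R K 2 μ) :
    ((Lp.memLp F).indicator hU).toLp _ ∈ extendByZero U (R V 2 (μ.restrict U)) := by
  have hco := ((Lp.memLp F).indicator hU).coeFn_toLp
  refine mem_extendByZero.2 ⟨?_, ?_⟩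
  · have h1 := R_le_comap_restrict hV μ U hF
    have h2 : LpToLpRestrictCLM ℂ ℂ ℂ μ 2 U (((Lp.memLp F).indicator hU).toLp _) =
        LpToLpRestrictCLM ℂ ℂ ℂ μ 2 U F := by
      refine Lp.ext ((LpToLpRestrictCLM_coeFn ℂ U _).trans
        (Filter.EventuallyEq.trans ?_ (LpToLpRestrictCLM_coeFn ℂ U F).symm))
      filter_upwards [ae_restrict_of_ae hco, ae_restrict_mem hU] with z hz hzU
      rw [hz, Set.indicator_of_mem hzU]
    rw [h2]
    exact h1
  · filter_upwards [ae_restrict_of_ae hco, ae_restrict_mem hU.compl] with z hz hzU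
    rw [hz, Set.indicator_of_notMem hzU]
    rfl

theorem extendByZero_isOrtho {μ : Measure ℂ} {U V : Set ℂ} (hU : MeasurableSet U)
    (hV : MeasurableSet V) (hUV : Disjoint U V) (N : Submodule ℂ (Lp ℂ 2 (μ.restrict U)))
    (N' : Submodule ℂ (Lp ℂ 2 (μ.restrict V))) : extendByZero U N ⟂ extendByZero V N' := by
  rw [Submodule.isOrtho_iff_inner_eq]
  intro F hF G hG
  have h1 := (ae_restrict_iff' hU.compl).1 (mem_extendByZero.1 hF).2
  have h2 := (ae_restrict_iff' hV.compl).1 (mem_extendByZero.1 hG).2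
  rw [L2.inner_def]
  refine integral_eq_zero_of_ae ?_
  filter_upwards [h1, h2] with z hz1 hz2
  by_cases hz : z ∈ U
  · simp [hz2 (Set.disjoint_left.1 hUV hz)]
  · simp [hz1 hz]

theorem KU_subset {K : Set ℂ} (hK : IsClosed K) : KU K ⊆ K :=
  closure_minimal (fun _ hz => interior_subset hz.1) hK

theorem KL_subset {K : Set ℂ} (hK : IsClosed K) : KL K ⊆ K :=
  closure_minimal (fun _ hz => interior_subset hz.1) hK

theorem disjoint_OmU_OmL (K : Set ℂ) : Disjoint (OmU K) (OmL K) := Set.disjoint_sdiff_right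

/-- The inclusion `≤` only restricts functions, as `Rat(K) ⊆ Rat(K_U)` and `Rat(K) ⊆ Rat(K_L)`. The
content is `≥`, which rests on the two characteristic functions and the approximation of poles. -/
theorem R_eq_sup {K : Set ℂ} (hK : IsCompact K) (hK1 : K ⊆ Metric.closedBall 0 1)
    (hint : interior {x : ℝ | (x : ℂ) ∈ K} = ∅) :
    R K 2 (areaW K) =
      extendByZero (OmU K) (R (KU K) 2 ((areaW K).restrict (OmU K))) ⊔
        extendByZero (OmL K) (R (KL K) 2 ((areaW K).restrict (OmL K))) := by
  apply le_antisymm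
  · intro F hF
    refine Submodule.mem_sup.2 ⟨_, indicator_mem_extendByZero (KU_subset hK.isClosed)
      (measurableSet_OmU K) hF, _, indicator_mem_extendByZero (KL_subset hK.isClosed)
      (measurableSet_OmL K) hF, ?_⟩
    refine Lp.ext ((Lp.coeFn_add _ _).trans ?_)
    filter_upwards [((Lp.memLp F).indicator (measurableSet_OmU K)).coeFn_toLp,
      ((Lp.memLp F).indicator (measurableSet_OmL K)).coeFn_toLp, ae_mem_Om K] with z h1 h2 hz
    rw [Pi.add_apply, h1, h2]
    by_cases h : z ∈ OmU K
    · have h' : z ∉ OmL K := fun h' => h'.2 h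
      simp [h, h']
    · have h' : z ∈ OmL K := ⟨hz, h⟩
      simp [h, h']
  · refine sup_le ?_ ?_
    · exact extendByZero_R_le (measurableSet_OmU K) fun f hf =>
        inR_indicator_rat hK (ae_mem K) (inR_indicator_OmU hK hK1 hint)
          (fun a ha => uniformlyApprox_OmU hK1 hint ha) hf
    · exact extendByZero_R_le (measurableSet_OmL K) fun f hf =>
        inR_indicator_rat hK (ae_mem K) (inR_indicator_OmL hK hK1 hint)
          (fun a ha => uniformlyApprox_OmL hK1 hint ha) hf

/-! ### The area mean value property and bounded point evaluations. -/

theorem integral_circleMap_Ioo {f : ℂ → ℂ} {c : ℂ} {r : ℝ} (hr : 0 ≤ r)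
    (hf : DiffContOnCl ℂ f (Metric.ball c r)) :
    ∫ θ in Set.Ioo (-Real.pi) Real.pi, f (circleMap c r θ) = 2 * Real.pi * f c := by
  have h1 : Real.circleAverage f c r = f c :=
    DiffContOnCl.circleAverage (by rwa [abs_of_nonneg hr])
  rw [Real.circleAverage_eq_integral_add (-Real.pi),
    intervalIntegral.integral_comp_add_right (fun θ => f (circleMap c r θ))] at h1
  rw [← integral_Ioc_eq_integral_Ioo, ← intervalIntegral.integral_of_le (by linarith [Real.pi_pos])]
  have h2 : (0 + -Real.pi) = -Real.pi := by ring
  have h3 : 2 * Real.pi + -Real.pi = Real.pi := by ring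
  rw [h2, h3] at h1
  rw [← h1, Complex.real_smul]
  have : (Real.pi : ℂ) ≠ 0 := by exact_mod_cast Real.pi_ne_zero
  push_cast
  field_simp

/-- The mean value property over disks. -/
theorem integral_ball_eq {f : ℂ → ℂ} {c : ℂ} {ρ : ℝ} (hρ : 0 < ρ)
    (hd : DifferentiableOn ℂ f (Metric.closedBall c ρ)) :
    ∫ z in Metric.ball c ρ, f z = (Real.pi * ρ ^ 2 : ℝ) * f c := by
  have hc := hd.continuousOn
  have hshift : ∫ z in Metric.ball c ρ, f z =
      ∫ z, (Metric.ball (0 : ℂ) ρ).indicator (fun z => f (c + z)) z := by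
    rw [← integral_indicator measurableSet_ball,
      ← integral_add_left_eq_self (fun z => (Metric.ball c ρ).indicator f z) c]
    congr 1
    funext z
    by_cases hz : z ∈ Metric.ball (0 : ℂ) ρ
    · have : c + z ∈ Metric.ball c ρ := by simpa using hz
      rw [Set.indicator_of_mem hz, Set.indicator_of_mem this]
    · have : c + z ∉ Metric.ball c ρ := by simpa using hz
      rw [Set.indicator_of_notMem hz, Set.indicator_of_notMem this]
  rw [hshift, ← Complex.integral_comp_polarCoord_symm]
  have hcm : ∀ p : ℝ × ℝ, c + Complex.polarCoord.symm p = circleMap c p.1 p.2 := by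
    intro p
    rw [Complex.polarCoord_symm_apply, circleMap, Complex.exp_mul_I]
    push_cast
    ring
  set g : ℝ × ℝ → ℂ := fun p => p.1 • f (circleMap c p.1 p.2) with hg
  have hset : ∫ p in polarCoord.target, p.1 •
      (Metric.ball (0 : ℂ) ρ).indicator (fun z => f (c + z)) (Complex.polarCoord.symm p) =
      ∫ p in Set.Ioo 0 ρ ×ˢ Set.Ioo (-Real.pi) Real.pi, g p := by
    rw [← integral_indicator polarCoord.open_target.measurableSet,
      ← integral_indicator (measurableSet_Ioo.prod measurableSet_Ioo)]
    congr 1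
    funext p
    by_cases hp : p ∈ polarCoord.target
    · rw [Set.indicator_of_mem hp]
      rw [polarCoord_target] at hp
      by_cases hpρ : p.1 < ρ
      · have h1 : p ∈ Set.Ioo 0 ρ ×ˢ Set.Ioo (-Real.pi) Real.pi := ⟨⟨hp.1, hpρ⟩, hp.2⟩
        have h2 : Complex.polarCoord.symm p ∈ Metric.ball (0 : ℂ) ρ := by
          rw [mem_ball_zero_iff, Complex.norm_polarCoord_symm, abs_of_pos hp.1]
          exact hpρ
        rw [Set.indicator_of_mem h1, Set.indicator_of_mem h2, hcm]
      · have h1 : p ∉ Set.Ioo 0 ρ ×ˢ Set.Ioo (-Real.pi) Real.pi := fun h => hpρ h.1.2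
        have h2 : Complex.polarCoord.symm p ∉ Metric.ball (0 : ℂ) ρ := by
          rw [mem_ball_zero_iff, Complex.norm_polarCoord_symm, abs_of_pos hp.1]
          exact hpρ
        rw [Set.indicator_of_notMem h1, Set.indicator_of_notMem h2, smul_zero]
    · rw [Set.indicator_of_notMem hp, Set.indicator_of_notMem]
      rintro ⟨h1, h2⟩
      exact hp (by rw [polarCoord_target]; exact ⟨h1.1, h2⟩)
  have hgc : ContinuousOn g (Set.Icc 0 ρ ×ˢ Set.Icc (-Real.pi) Real.pi) := by
    refine continuous_fst.continuousOn.smul (hc.comp ?_ ?_)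
    · unfold circleMap
      fun_prop
    · intro p hp
      rw [mem_closedBall_iff_norm, circleMap_sub_center, norm_circleMap_zero,
        abs_of_nonneg hp.1.1]
      exact hp.1.2
  have hint : IntegrableOn g (Set.Ioo 0 ρ ×ˢ Set.Ioo (-Real.pi) Real.pi)
      ((volume : Measure ℝ).prod volume) := by
    rw [← Measure.volume_eq_prod]
    exact (hgc.integrableOn_compact (isCompact_Icc.prod isCompact_Icc)).mono_set
      (Set.prod_mono Set.Ioo_subset_Icc_self Set.Ioo_subset_Icc_self)
  rw [hset, Measure.volume_eq_prod, setIntegral_prod _ hint]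
  have hinner : ∀ r ∈ Set.Ioo 0 ρ, ∫ θ in Set.Ioo (-Real.pi) Real.pi, g (r, θ) =
      ((r * (2 * Real.pi) : ℝ) : ℂ) * f c := by
    intro r hr
    simp only [hg]
    rw [integral_smul, integral_circleMap_Ioo hr.1.le, Complex.real_smul]
    · push_cast
      ring
    · refine DifferentiableOn.diffContOnCl (hd.mono ?_)
      exact Metric.closure_ball_subset_closedBall.trans (Metric.closedBall_subset_closedBall hr.2.le)
  rw [setIntegral_congr_fun measurableSet_Ioo hinner, integral_mul_const, integral_complex_ofReal,
    integral_mul_const, ← integral_Ioc_eq_integral_Ioo, ← intervalIntegral.integral_of_le hρ.le,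
    integral_id]
  congr 2
  ring

/-- On a closed disk in `Ω` the area is dominated by a multiple of the weighted area. -/
theorem exists_smul_restrict_le {K : Set ℂ} (hint : interior {x : ℝ | (x : ℂ) ∈ K} = ∅)
    {z₀ : ℂ} {ρ : ℝ} (h : Metric.closedBall z₀ ρ ⊆ Om K) :
    ∃ δ : ℝ≥0, 0 < δ ∧ (δ : ℝ≥0∞) • (volume : Measure ℂ).restrict (Metric.closedBall z₀ ρ) ≤
      areaW K := by
  obtain ⟨δ, hδ, hδW⟩ : ∃ δ : ℝ≥0, 0 < δ ∧ ∀ z ∈ Metric.closedBall z₀ ρ, (δ : ℝ) ≤ |z.im| ^ 4 := by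
    rcases (Metric.closedBall z₀ ρ).eq_empty_or_nonempty with he | hne
    · exact ⟨1, one_pos, by simp [he]⟩
    · obtain ⟨w, hw, hmin⟩ := (isCompact_closedBall z₀ ρ).exists_isMinOn hne
        (f := fun z : ℂ => |z.im| ^ 4) (by fun_prop)
      have hpos : 0 < |w.im| := abs_pos.2 (im_ne_zero_of_mem_Om hint (h hw))
      exact ⟨⟨|w.im| ^ 4, by positivity⟩, by exact_mod_cast pow_pos hpos 4, fun z hz => hmin hz⟩
  refine ⟨δ, hδ, ?_⟩
  rw [← withDensity_const, ← withDensity_indicator measurableSet_closedBall]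
  refine withDensity_mono (Filter.Eventually.of_forall fun z => ?_)
  by_cases hz : z ∈ Metric.closedBall z₀ ρ
  · simp only [hz, Set.indicator_of_mem]
    rw [weight_of_mem (h hz), ← ENNReal.ofReal_coe_nnreal]
    exact ENNReal.ofReal_le_ofReal (hδW z hz)
  · simp [hz]

theorem restrict_closedBall_absolutelyContinuous {K : Set ℂ}
    (hint : interior {x : ℝ | (x : ℂ) ∈ K} = ∅) {z₀ : ℂ} {ρ : ℝ}
    (h : Metric.closedBall z₀ ρ ⊆ Om K) :
    (volume : Measure ℂ).restrict (Metric.closedBall z₀ ρ) ≪ areaW K := by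
  obtain ⟨δ, hδ, hle⟩ := exists_smul_restrict_le hint h
  refine (Measure.absolutelyContinuous_smul (c := (δ : ℝ≥0∞)) (by exact_mod_cast hδ.ne')).trans ?_
  exact Measure.absolutelyContinuous_of_le hle

/-- The `L¹` norm over a closed disk in `Ω` is controlled by the `L²(W dA)` norm. -/
theorem exists_eLpNorm_one_le {K : Set ℂ} (hint : interior {x : ℝ | (x : ℂ) ∈ K} = ∅)
    {z₀ : ℂ} {ρ : ℝ} (h : Metric.closedBall z₀ ρ ⊆ Om K) :
    ∃ C : ℝ≥0, ∀ f : ℂ → ℂ, AEStronglyMeasurable f (volume.restrict (Metric.closedBall z₀ ρ)) →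
      eLpNorm f 1 (volume.restrict (Metric.closedBall z₀ ρ)) ≤ C * eLpNorm f 2 (areaW K) := by
  obtain ⟨δ, hδ, hle⟩ := exists_smul_restrict_le hint h
  set B := Metric.closedBall z₀ ρ
  have hδ0 : (δ : ℝ≥0∞) ≠ 0 := by exact_mod_cast hδ.ne'
  set e : ℝ≥0∞ := (δ : ℝ≥0∞) ^ (1 / (2 : ℝ≥0∞)).toReal with he
  have he0 : e ≠ 0 := (ENNReal.rpow_pos (pos_iff_ne_zero.2 hδ0) ENNReal.coe_ne_top).ne'
  have het : e ≠ ∞ := ENNReal.rpow_ne_top_of_nonneg (by simp) ENNReal.coe_ne_top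
  set v : ℝ≥0∞ := (volume.restrict B Set.univ) ^
    (1 / (1 : ℝ≥0∞).toReal - 1 / (2 : ℝ≥0∞).toReal) with hv
  have hvt : v ≠ ∞ := by
    refine ENNReal.rpow_ne_top_of_nonneg (by norm_num) ?_
    rw [Measure.restrict_apply_univ]
    exact measure_closedBall_lt_top.ne
  have hC : v * e⁻¹ ≠ ∞ := ENNReal.mul_ne_top hvt (ENNReal.inv_ne_top.2 he0)
  refine ⟨(v * e⁻¹).toNNReal, fun f hf => ?_⟩
  rw [ENNReal.coe_toNNReal hC]
  have h1 := eLpNorm_le_eLpNorm_mul_rpow_measure_univ (p := 1) (q := 2) (by norm_num) hf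
  have h2 := eLpNorm_mono_measure (p := 2) f hle
  rw [eLpNorm_smul_measure_of_ne_top (by norm_num), smul_eq_mul] at h2
  calc eLpNorm f 1 (volume.restrict B) ≤ eLpNorm f 2 (volume.restrict B) * v := h1
    _ ≤ (e⁻¹ * eLpNorm f 2 (areaW K)) * v := by
        gcongr
        rw [mul_comm, ← div_eq_mul_inv, ENNReal.le_div_iff_mul_le (Or.inl he0) (Or.inl het),
          mul_comm]
        exact h2
    _ = v * e⁻¹ * eLpNorm f 2 (areaW K) := by ring

/-- Averaging over disks of the fixed radius `ρ` about all `z` near `z₀` thus stays in one compact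
disk, where one constant compares `dA` with `W dA`. -/
theorem closedBall_subset_double {z z₀ : ℂ} {ρ : ℝ} (hz : z ∈ Metric.ball z₀ ρ) :
    Metric.closedBall z ρ ⊆ Metric.closedBall z₀ (2 * ρ) := by
  apply Metric.closedBall_subset_closedBall'
  linarith [Metric.mem_ball.1 hz]

theorem enorm_integral_ball_le {f : ℂ → ℂ} {z z₀ : ℂ} {ρ : ℝ} (hz : z ∈ Metric.ball z₀ ρ) :
    ‖∫ w in Metric.ball z ρ, f w‖ₑ ≤
      eLpNorm f 1 (volume.restrict (Metric.closedBall z₀ (2 * ρ))) := by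
  refine (enorm_integral_le_lintegral_enorm _).trans ?_
  rw [eLpNorm_one_eq_lintegral_enorm]
  exact lintegral_mono_set (Metric.ball_subset_closedBall.trans (closedBall_subset_double hz))

theorem exists_double_closedBall_subset {U : Set ℂ} (hU : IsOpen U) {z₀ : ℂ} (h : z₀ ∈ U) :
    ∃ ρ : ℝ, 0 < ρ ∧ Metric.closedBall z₀ (2 * ρ) ⊆ U := by
  obtain ⟨ε, hε, hsub⟩ := Metric.nhds_basis_closedBall.mem_iff.1 (hU.mem_nhds h)
  exact ⟨ε / 2, by positivity, by rwa [mul_div_cancel₀ _ two_ne_zero]⟩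

/-- Locally uniform boundedness of point evaluations on `Ω`. -/
theorem exists_point_bound {K : Set ℂ} (hint : interior {x : ℝ | (x : ℂ) ∈ K} = ∅) {z₀ : ℂ}
    (h : z₀ ∈ Om K) : ∃ ρ : ℝ, 0 < ρ ∧ ∃ M : ℝ≥0, ∀ z ∈ Metric.ball z₀ ρ, ∀ f ∈ Rat K,
      ‖f z‖ₑ ≤ M * eLpNorm f 2 (areaW K) := by
  obtain ⟨ρ, hρ, hsub⟩ := exists_double_closedBall_subset (isOpen_Om K) h
  obtain ⟨C, hC⟩ := exists_eLpNorm_one_le hint hsub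
  have hA : 0 < Real.pi * ρ ^ 2 := by positivity
  refine ⟨ρ, hρ, (Real.pi * ρ ^ 2).toNNReal⁻¹ * C, fun z hz f hf => ?_⟩
  have h1 := integral_ball_eq hρ ((Rat.differentiableOn hf).mono
    ((closedBall_subset_double hz).trans (hsub.trans interior_subset)))
  have h2 := (enorm_integral_ball_le (f := f) hz).trans
    (hC f (Rat.measurable hf).aestronglyMeasurable)
  rw [h1, enorm_mul] at h2
  have h3 : ‖((Real.pi * ρ ^ 2 : ℝ) : ℂ)‖ₑ = ((Real.pi * ρ ^ 2).toNNReal : ℝ≥0∞) := by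
    rw [← ofReal_norm, Complex.norm_real, Real.norm_of_nonneg hA.le]
    rfl
  have hne : (Real.pi * ρ ^ 2).toNNReal ≠ 0 := (Real.toNNReal_pos.2 hA).ne'
  rw [h3] at h2
  rw [ENNReal.coe_mul, ENNReal.coe_inv hne, mul_assoc, mul_comm _ (_ * _), ← div_eq_mul_inv,
    ENNReal.le_div_iff_mul_le (Or.inl (by exact_mod_cast hne)) (Or.inl ENNReal.coe_ne_top),
    mul_comm]
  exact h2

/-- One inclusion holds because `bpe` is contained in `K`; the other is the local bound
`exists_point_bound`. -/
theorem abpe_eq_Om {K : Set ℂ} (hint : interior {x : ℝ | (x : ℂ) ∈ K} = ∅) :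
    abpe K 2 (areaW K) = Om K := by
  apply Set.Subset.antisymm
  · rintro z ⟨hz, -⟩
    exact interior_mono (fun w hw => hw.1) hz
  · intro z hz
    refine ⟨interior_maximal (fun w hw => ?_) (isOpen_Om K) hz, exists_point_bound hint hz⟩
    obtain ⟨ρ, hρ, M, hM⟩ := exists_point_bound hint hw
    exact ⟨interior_subset hw, M, hM w (Metric.mem_ball_self hρ)⟩

/-! ### Purity and positivity of the measure on open sets. -/

/-- Members of `R²(K, W dA)` satisfy the mean value property almost everywhere. -/
theorem ae_mean_value {K : Set ℂ} (hint : interior {x : ℝ | (x : ℂ) ∈ K} = ∅) {z₀ : ℂ} {ρ : ℝ}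
    (hρ : 0 < ρ) (h : Metric.closedBall z₀ (2 * ρ) ⊆ Om K) {F : Lp ℂ 2 (areaW K)}
    (hF : F ∈ R K 2 (areaW K)) : ∀ᵐ z ∂areaW K, z ∈ Metric.ball z₀ ρ →
      ∫ w in Metric.ball z ρ, F w = (Real.pi * ρ ^ 2 : ℝ) * F z := by
  have hac := restrict_closedBall_absolutelyContinuous hint h
  have hspan : ∀ u : Lp ℂ 2 (areaW K), u ∈ Submodule.span ℂ
      {f : Lp ℂ 2 (areaW K) | ∃ k ∈ Rat K, f =ᵐ[areaW K] k} →
      ∃ g : ℂ → ℂ, DifferentiableOn ℂ g (Om K) ∧ u =ᵐ[areaW K] g := by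
    intro u hu
    induction hu using Submodule.span_induction with
    | mem f hf =>
      obtain ⟨k, hk, hfk⟩ := hf
      exact ⟨k, (Rat.differentiableOn hk).mono interior_subset, hfk⟩
    | zero => exact ⟨0, differentiableOn_const 0, Lp.coeFn_zero _ _ _⟩
    | add f k _ _ hf hk =>
      obtain ⟨g, hg, hfg⟩ := hf
      obtain ⟨l, hl, hkl⟩ := hk
      exact ⟨g + l, hg.add hl, (Lp.coeFn_add f k).trans (hfg.add hkl)⟩
    | smul c f _ hf =>
      obtain ⟨g, hg, hfg⟩ := hf
      exact ⟨c • g, hg.const_smul c, (Lp.coeFn_smul c f).trans (hfg.const_smul c)⟩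
  obtain ⟨u, hu, hlim⟩ := mem_closure_iff_seq_limit.1 hF
  choose g hg hug using fun n => hspan (u n) (hu n)
  -- The integrals over disks converge along the whole sequence by the `L¹` bound; the point values
  -- need an a.e. convergent subsequence.
  obtain ⟨ns, hns, hae⟩ := (tendstoInMeasure_of_tendsto_Lp hlim).exists_seq_tendsto_ae
  obtain ⟨C, hC⟩ := exists_eLpNorm_one_le hint h
  have hL2 := (Lp.tendsto_Lp_iff_tendsto_eLpNorm' u F).1 hlim
  have hintg : ∀ G : Lp ℂ 2 (areaW K),
      Integrable G (volume.restrict (Metric.closedBall z₀ (2 * ρ))) := fun G => by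
    rw [← memLp_one_iff_integrable]
    refine ⟨(Lp.stronglyMeasurable G).aestronglyMeasurable,
      (hC G (Lp.stronglyMeasurable G).aestronglyMeasurable).trans_lt ?_⟩
    exact ENNReal.mul_lt_top ENNReal.coe_lt_top (Lp.eLpNorm_lt_top G)
  filter_upwards [hae, ae_all_iff.2 hug] with z hz hzg hzb
  have hsubB : Metric.ball z ρ ⊆ Metric.closedBall z₀ (2 * ρ) :=
    Metric.ball_subset_closedBall.trans (closedBall_subset_double hzb)
  have hmv : ∀ n, ∫ w in Metric.ball z ρ, u n w = (Real.pi * ρ ^ 2 : ℝ) * u n z := by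
    intro n
    have h1 : ∫ w in Metric.ball z ρ, u n w = ∫ w in Metric.ball z ρ, g n w :=
      integral_congr_ae (ae_restrict_of_ae_restrict_of_subset hsubB (hac.ae_le (hug n)))
    rw [h1, integral_ball_eq hρ ((hg n).mono ((closedBall_subset_double hzb).trans h)), hzg n]
  have hlimI : Filter.Tendsto (fun n => ∫ w in Metric.ball z ρ, u n w) Filter.atTop
      (nhds (∫ w in Metric.ball z ρ, F w)) := by
    rw [tendsto_iff_edist_tendsto_0]
    have h0 : Filter.Tendsto (fun n => C * eLpNorm (⇑(u n) - ⇑F) 2 (areaW K)) Filter.atTop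
        (nhds 0) := by
      have := ENNReal.Tendsto.const_mul (a := (C : ℝ≥0∞)) hL2 (Or.inr ENNReal.coe_ne_top)
      simpa using this
    refine tendsto_of_tendsto_of_tendsto_of_le_of_le tendsto_const_nhds h0 (fun _ => zero_le)
      fun n => ?_
    rw [edist_eq_enorm_sub,
      ← integral_sub ((hintg (u n)).mono_measure (Measure.restrict_mono_set _ hsubB))
      ((hintg F).mono_measure (Measure.restrict_mono_set _ hsubB))]
    exact (enorm_integral_ball_le (f := ⇑(u n) - ⇑F) hzb).trans (hC _
      ((Lp.stronglyMeasurable (u n)).sub (Lp.stronglyMeasurable F)).aestronglyMeasurable)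
  refine tendsto_nhds_unique (hlimI.comp hns.tendsto_atTop) ?_
  simp only [Function.comp_def, hmv]
  exact hz.const_mul _

theorem isPure_areaW {K : Set ℂ} (hK1 : K ⊆ Metric.closedBall 0 1)
    (hint : interior {x : ℝ | (x : ℂ) ∈ K} = ∅) : IsPure K 2 (areaW K) := by
  have := isFiniteMeasure_areaW hK1
  rintro ⟨Δ, hΔ, hpos, N, hR⟩
  have hpos' : areaW K (Δ ∩ Om K) ≠ 0 := by
    rw [Set.inter_comm, Measure.measure_inter_eq_of_ae (ae_mem_Om K)]
    exact hpos.ne'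
  -- A point of `Δ ∩ Ω` near which `Δ ∩ Ω` always has positive measure.
  obtain ⟨z₀, hz₀, hnhds⟩ := exists_mem_forall_mem_nhdsWithin_pos_measure hpos'
  obtain ⟨ρ, hρ, hsub⟩ := exists_double_closedBall_subset (isOpen_Om K) hz₀.2
  -- The summand `L²(μ|_Δ)` contains `χ_D`. The mean value property at a point of `D` would give `D`
  -- area at least `πρ²`, while `D` lies in a disk of area `πρ²/4`.
  set D : Set ℂ := Δ ∩ Metric.ball z₀ (ρ / 2) with hD
  have hDm : MeasurableSet D := hΔ.inter measurableSet_ball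
  have hDpos : areaW K D ≠ 0 := by
    refine (lt_of_lt_of_le (hnhds _ (inter_mem_nhdsWithin _
      (Metric.ball_mem_nhds z₀ (half_pos hρ)))) (measure_mono ?_)).ne'
    exact Set.inter_subset_inter_left _ Set.inter_subset_left
  have hmem : MemLp (D.indicator fun _ => (1 : ℂ)) 2 (areaW K) := (memLp_const 1).indicator hDm
  set F := hmem.toLp _ with hF
  have hFco : F =ᵐ[areaW K] D.indicator fun _ => (1 : ℂ) := hmem.coeFn_toLp
  have hFR : F ∈ R K 2 (areaW K) := by
    rw [hR]
    refine Submodule.mem_sup_left (mem_extendByZero.2 ⟨Submodule.mem_top, ?_⟩)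
    filter_upwards [ae_restrict_of_ae hFco, ae_restrict_mem hΔ.compl] with z hz hzΔ
    rw [hz, Set.indicator_of_notMem fun hzD : z ∈ D => hzΔ hzD.1]
    rfl
  obtain ⟨z, hzD, hzF, hzm⟩ := ((frequently_ae_mem_iff.2 hDpos).and_eventually
    (hFco.and (ae_mean_value hint hρ hsub hFR))).exists
  have hzb : z ∈ Metric.ball z₀ ρ := Metric.ball_subset_ball (by linarith) hzD.2
  have hsubB : Metric.ball z ρ ⊆ Metric.closedBall z₀ (2 * ρ) :=
    Metric.ball_subset_closedBall.trans (closedBall_subset_double hzb)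
  have h1 := hzm hzb
  have hac := restrict_closedBall_absolutelyContinuous hint hsub
  rw [hzF, Set.indicator_of_mem hzD, mul_one, integral_congr_ae
    (ae_restrict_of_ae_restrict_of_subset hsubB (hac.ae_le hFco)),
    integral_indicator_const _ hDm, Complex.real_smul, mul_one, Complex.ofReal_inj] at h1
  have h2 : (volume.restrict (Metric.ball z ρ)).real D ≤
      (volume : Measure ℂ).real (Metric.ball z₀ (ρ / 2)) := by
    rw [measureReal_restrict_apply hDm]
    exact measureReal_mono (Set.inter_subset_left.trans Set.inter_subset_right)
      measure_ball_lt_top.ne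
  have h3 : (volume : Measure ℂ).real (Metric.ball z₀ (ρ / 2)) = Real.pi * (ρ / 2) ^ 2 := by
    rw [Measure.real, Complex.volume_ball, ENNReal.toReal_mul, ENNReal.toReal_pow,
      ENNReal.toReal_ofReal (by positivity)]
    simp [mul_comm]
  rw [h1, h3] at h2
  nlinarith [mul_pos Real.pi_pos (pow_pos hρ 2)]

theorem areaW_pos_of_isOpen {K U : Set ℂ} (hint : interior {x : ℝ | (x : ℂ) ∈ K} = ∅)
    (hU : IsOpen U) (hUK : U ⊆ Om K) (hne : U.Nonempty) : 0 < areaW K U := by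
  obtain ⟨z₀, hz₀⟩ := hne
  obtain ⟨ρ, hρ, hsub⟩ := exists_double_closedBall_subset hU hz₀
  have hac := restrict_closedBall_absolutelyContinuous hint (hsub.trans hUK)
  refine pos_iff_ne_zero.2 fun h0 => ?_
  have h1 := hac h0
  rw [Measure.restrict_apply hU.measurableSet, Set.inter_eq_right.2 hsub] at h1
  exact (Metric.measure_closedBall_pos volume z₀ (by positivity : 0 < 2 * ρ)).ne' h1

theorem isOpen_OmL {K : Set ℂ} (hint : interior {x : ℝ | (x : ℂ) ∈ K} = ∅) : IsOpen (OmL K) := by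
  have : OmL K = Om K ∩ {z | z.im < 0} := by
    ext z
    exact mem_OmL_iff hint
  rw [this]
  exact (isOpen_Om K).inter (isOpen_lt Complex.continuous_im continuous_const)

/-! ### String of beads sets -/

theorem beadSet_subset (lam r : ℕ → ℝ) : beadSet lam r ⊆ Metric.closedBall 0 1 :=
  Set.sdiff_subset

theorem isCompact_beadSet (lam r : ℕ → ℝ) : IsCompact (beadSet lam r) :=
  (isCompact_closedBall 0 1).diff (isOpen_iUnion fun _ => Metric.isOpen_ball)

/-- The disks are disjoint inside a disk of finite area. -/
theorem IsStringOfBeads.finite_le_radius {lam r : ℕ → ℝ} (h : IsStringOfBeads lam r) {ε : ℝ}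
    (hε : 0 < ε) : {n | ε ≤ r n}.Finite := by
  have hfin : volume (⋃ n, Metric.ball (lam n : ℂ) (r n)) ≠ ∞ :=
    ((measure_mono (Set.iUnion_subset h.ball_subset)).trans_lt measure_ball_lt_top).ne
  have := Measure.finite_const_le_meas_of_disjoint_iUnion (volume : Measure ℂ)
    (Metric.measure_ball_pos volume (0 : ℂ) hε) (fun n => measurableSet_ball)
    (fun i j hij => (h.disjoint i j hij).mono Metric.ball_subset_closedBall
      Metric.ball_subset_closedBall) hfin
  refine this.subset fun n hn => ?_
  rw [Set.mem_ofPred_eq, Measure.addHaar_ball_center volume (lam n : ℂ)]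
  exact measure_mono (Metric.ball_subset_ball hn)

/-- Off the real axis, the closed disks of a string of beads are locally finite. -/
theorem IsStringOfBeads.mem_Om {lam r : ℕ → ℝ} (h : IsStringOfBeads lam r) {z : ℂ}
    (hz1 : ‖z‖ < 1) (him : z.im ≠ 0) (hz : ∀ n, z ∉ Metric.closedBall (lam n : ℂ) (r n)) :
    z ∈ Om (beadSet lam r) := by
  -- A disk centred on `ℝ` of radius below `η` lies in `|Im w| < η`, hence misses the ball of radius
  -- `η` about `z`; only finitely many disks remain to be avoided.
  set η : ℝ := |z.im| / 2 with hη
  have hη0 : 0 < η := by positivity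
  have hfin := h.finite_le_radius hη0
  have hopen : IsOpen (Metric.ball (0 : ℂ) 1 ∩ Metric.ball z η ∩
      ⋂ n ∈ {n | η ≤ r n}, (Metric.closedBall (lam n : ℂ) (r n))ᶜ) :=
    (Metric.isOpen_ball.inter Metric.isOpen_ball).inter
      (hfin.isOpen_biInter fun n _ => Metric.isClosed_closedBall.isOpen_compl)
  refine interior_maximal (fun w hw => ?_) hopen
    ⟨⟨by simpa using hz1, Metric.mem_ball_self hη0⟩, by simpa using fun n _ => hz n⟩
  obtain ⟨⟨hw1, hw2⟩, hw3⟩ := hw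
  refine ⟨Metric.ball_subset_closedBall hw1, fun hwU => ?_⟩
  obtain ⟨n, hn⟩ := Set.mem_iUnion.1 hwU
  by_cases hrn : η ≤ r n
  · exact Set.mem_iInter₂.1 hw3 n hrn (Metric.ball_subset_closedBall hn)
  · have h1 : |w.im| < r n := by
      have := Complex.abs_im_le_norm (w - lam n)
      rw [Metric.mem_ball, dist_eq_norm] at hn
      simp only [Complex.sub_im, Complex.ofReal_im, sub_zero] at this
      linarith
    have h2 : |z.im - w.im| < η := by
      have := Complex.abs_im_le_norm (z - w)
      rw [Metric.mem_ball, dist_eq_norm, norm_sub_rev] at hw2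
      rw [Complex.sub_im] at this
      linarith
    have h3 := abs_sub_abs_le_abs_sub z.im w.im
    linarith

/-- Otherwise `K ∩ ℝ ⊆ {1, -1}` would have length zero. -/
theorem IsStringOfBeads.exists_real_mem {lam r : ℕ → ℝ} (h : IsStringOfBeads lam r) :
    ∃ x : ℝ, |x| < 1 ∧ (x : ℂ) ∈ beadSet lam r := by
  by_contra hcon
  push Not at hcon
  have hsub : {x : ℝ | (x : ℂ) ∈ beadSet lam r} ⊆ {1, -1} := by
    intro x hx
    have h1 : |x| ≤ 1 := by simpa using beadSet_subset lam r hx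
    have h2 : |x| = 1 := le_antisymm h1 (not_lt.1 fun hlt => hcon x hlt hx)
    rcases eq_or_eq_neg_of_abs_eq h2 with h | h <;> simp [h]
  have := h.real_length_pos.trans_le (measure_mono hsub)
  rw [(Set.toFinite _).measure_zero] at this
  exact lt_irrefl _ this

/-- Above and below an interior real point of a string of beads set there are points of `Ω`. -/
theorem IsStringOfBeads.add_mul_I_mem_Om {lam r : ℕ → ℝ} (h : IsStringOfBeads lam r) {x y : ℝ}
    (hx : (x : ℂ) ∈ beadSet lam r) (hy : y ≠ 0) (hxy : |x| + |y| < 1) :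
    (x + y * Complex.I : ℂ) ∈ Om (beadSet lam r) := by
  refine h.mem_Om ?_ (by simpa using hy) fun n hn => ?_
  · refine (norm_add_le _ _).trans_lt ?_
    simpa using hxy
  · have h1 : r n ≤ |x - lam n| := by
      have : (x : ℂ) ∉ Metric.ball (lam n : ℂ) (r n) := fun hmem =>
        hx.2 (Set.mem_iUnion.2 ⟨n, hmem⟩)
      rw [Metric.mem_ball, Complex.isometry_ofReal.dist_eq, Real.dist_eq, not_lt] at this
      exact this
    rw [Metric.mem_closedBall, dist_eq_norm] at hn
    -- Pythagoras: a vertical move strictly increases the distance to a real centre, so the point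
    -- leaves the closed disk even when `x` lies on its boundary.
    have h2 : ‖(x + y * Complex.I : ℂ) - lam n‖ ^ 2 = |x - lam n| ^ 2 + y ^ 2 := by
      rw [Complex.sq_norm, Complex.normSq_apply, sq_abs]
      simp
      ring
    have h3 : 0 < y ^ 2 := by positivity
    have h4 := pow_le_pow_left₀ (norm_nonneg _) hn 2
    have h5 := pow_le_pow_left₀ (h.radius_pos n).le h1 2
    linarith

end StringOfBeads

open StringOfBeads in
theorem mainTheorem5 (lam r : ℕ → ℝ) (h : IsStringOfBeads lam r)
    (K : Set ℂ) (hK : K = beadSet lam r) :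
    -- multiplication by `z` on `R²(K, W dA)` is pure
    IsPure K 2 (areaW K) ∧
    -- the set of analytic bounded point evaluations is `Ω`
    abpe K 2 (areaW K) = Om K ∧
    -- the characteristic function of `Ω_U` is in `R²(K, W dA)`
    (∃ f ∈ R K 2 (areaW K), f =ᵐ[areaW K] (OmU K).indicator (fun _ => (1 : ℂ))) ∧
    -- `R²(K, W dA) = R²(K_U, W dA|Ω_U) ⊕ R²(K_L, W dA|Ω_L)`, an orthogonal direct sum,
    -- and neither part is trivial
    R K 2 (areaW K) =
      extendByZero (OmU K) (R (KU K) 2 ((areaW K).restrict (OmU K))) ⊔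
        extendByZero (OmL K) (R (KL K) 2 ((areaW K).restrict (OmL K))) ∧
    extendByZero (OmU K) (R (KU K) 2 ((areaW K).restrict (OmU K))) ⟂
      extendByZero (OmL K) (R (KL K) 2 ((areaW K).restrict (OmL K))) ∧
    0 < areaW K (OmU K) ∧ 0 < areaW K (OmL K) := by
  have hint : interior {x : ℝ | (x : ℂ) ∈ K} = ∅ := hK ▸ h.real_interior
  have hKc : IsCompact K := hK ▸ isCompact_beadSet lam r
  have hK1 : K ⊆ Metric.closedBall 0 1 := hK ▸ beadSet_subset lam r
  obtain ⟨x, hx1, hx⟩ := h.exists_real_mem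
  obtain ⟨y, hy0, hy⟩ : ∃ y : ℝ, 0 < y ∧ |x| + y < 1 := ⟨(1 - |x|) / 2, by linarith, by linarith⟩
  refine ⟨isPure_areaW hK1 hint, abpe_eq_Om hint, inR_indicator_OmU hKc hK1 hint,
    R_eq_sup hKc hK1 hint, extendByZero_isOrtho (measurableSet_OmU K) (measurableSet_OmL K)
      (disjoint_OmU_OmL K) _ _, ?_, ?_⟩
  · refine areaW_pos_of_isOpen hint (isOpen_OmU K) (fun z hz => hz.1)
      ⟨(x + y * Complex.I : ℂ), ?_, by simpa using hy0⟩
    rw [hK]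
    exact h.add_mul_I_mem_Om hx hy0.ne' (by rwa [abs_of_pos hy0])
  · refine areaW_pos_of_isOpen hint (isOpen_OmL hint) (fun z hz => hz.1)
      ⟨(x + (-y : ℝ) * Complex.I : ℂ), (mem_OmL_iff hint).2 ⟨?_, by simpa using hy0⟩⟩
    rw [hK]
    exact h.add_mul_I_mem_Om hx (neg_ne_zero.2 hy0.ne') (by rwa [abs_neg, abs_of_pos hy0])
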